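/- Let $p=2t+1$ be an odd prime and $w\ge 1$. A block label $\rho^w$ consists of a $p$-bar core $\rho$ (a strict partition from which no $p$-bar can be removed, where removing a $p$-bar means lowering a part $a>p$ to $a-p$ if $a-p$ is not a part or $p\mid a$, deleting a part $p$, or deleting two parts with sum $p$) and the weight $w$; a $p$-strict partition (no repeated parts except multiples of $p$) belongs to $\rho^w$ if removing $w$ $p$-bars from it leads to $\rho$. The label $\rho^w$ stands for the spin blocks of $\tilde S_n$ and $\tilde A_n$ with core $\rho$ and weight $w$, where $n=|\rho|+pw$ is called its rank. The core $\rho$ is encoded by its core tuple $((\ell_1,\epsilon_1),\dots,(\ell_t,\epsilon_t))$, where $\ell_i$ is the number of parts of $\rho$ congruent to $i$ or $-i$ modulo $p$, and $\epsilon_i=0$ if $\rho$ has a part congruent to $i$, $\epsilon_i=1$ otherwise. The block-reduced crystal graph has the block labels as vertices and, for $i\in\{0,\dots,t\}$, an edge labelled $i$ between two blocks whenever some $p$-restricted partition in the one is obtained from a $p$-restricted partition in the other by adding an $i$-cogood node or by removing an $i$-good node. (A $p$-strict partition is $p$-restricted if consecutive parts, including the $0$ after the last part, differ by at most $p$, and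 by less than $p$ if the larger is divisible by $p$. Rows of Young diagrams are filled with repetitions of the residues $0,1,\dots,t-1,t,t-1,\dots,1,0$, and good and cogood nodes are those of the usual $i$-signature rule of Kang and Brundan--Kleshchev for $p$-strict partitions.) A maximal sequence of blocks connected by edges labelled $i$ is a maximal $i$-string. A block lies at the high-rank (low-rank) end of its maximal $i$-string if no $i$-edge leads from it to a block of higher (lower) rank. The Scopes involutions $K_0,\dots,K_t$ act on cores as follows: $K_i$ ($0<i<t$) interchanges $(\ell_i,\epsilon_i)$ and $(\ell_{i+1},\epsilon_{i+1})$; $K_t$ interchanges the runners $t$ and $t+1$ of the abacus; $K_0$ interchanges the parts $ap+1$ with $a\ge1$ and the parts $ap-1$ with $a\geq 1$ (so that $ap+1\leftrightarrow ap-1$), and removes the part $1$ if present, adding it otherwise. The action $\rho^w\mapsto (K_i\rho)^w$ is $w$-allowed if $\rho^w$ lies at an end of its maximal $i$-string. Two blocks of weight $w$ are allowed equivalent if one is obtained from the other by a sequence of $w$-allowed actions. Let $\rho_w$ be the RoCK core, with core tuple $\ell_i=w+(i-1)(w-1)$, $\epsilon_i=0$ for $1\le i\le t$. Then the block $\rho_w^w$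 has rank $$N=pw+\Bigl(\frac{p(w-1)}{2}+1\Bigr)\sum_{i=1}^t\bigl(i^2(w-1)+i\bigr).$$ It cannot be lowered (no single $w$-allowed action strictly decreases its rank), and every other block of weight $w$ that cannot be lowered has rank strictly less than $N$. Likewise, $\rho_w^w$ does not lie at the high-rank end of its maximal $i$-string for any $i\in\{0,\dots,t\}$, and every other block of weight $w$ with this property has rank strictly less than $N$. Consequently every block of weight $w$ is allowed equivalent to a block of rank at most $N$, and this bound is sharp: no block allowed equivalent to $\rho_w^w$ has rank less than $N$. -/

import Mathlib

namespace SpinCrystal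

/-! Partitions are Young diagrams in English notation; the node `(r, s)` lies in row `r` and
column `s`, both counted from `0`. Throughout, `p` is an odd prime and `t = (p - 1) / 2`. -/

/-- The multiset of (positive) parts of a partition. -/
def parts (l : YoungDiagram) : Multiset ℕ := (l.rowLens : Multiset ℕ)

/-- A `p`-strict partition: no repeated parts, except possibly parts divisible by `p`. (Two
consecutive rows of length `0` are harmless because `p ∣ 0`.) -/
def IsPStrict (p : ℕ) (l : YoungDiagram) : Prop :=
  ∀ r, l.rowLen r = l.rowLen (r + 1) → p ∣ l.rowLen r

/-- A `p`-restricted partition: `p`-strict, consecutive rows (including the empty row after the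
last one) differ by at most `p`, and differ by less than `p` if the longer one is divisible
by `p`. -/
def IsPRestricted (p : ℕ) (l : YoungDiagram) : Prop :=
  IsPStrict p l ∧ ∀ r, l.rowLen r - l.rowLen (r + 1) ≤ p ∧
    (l.rowLen r - l.rowLen (r + 1) = p → ¬ p ∣ l.rowLen r)

/-! ### Bar cores, weights and blocks -/

/-- `m` is obtained from the `p`-strict partition `l` by removing one `p`-bar: lowering a part
`a > p` to `a - p` (when that place is empty, or lies on runner `0`, where repetitions are
allowed), or deleting a part `p`, or deleting two parts with sum `p`. -/
def RemovesBar (p : ℕ) (l m : YoungDiagram) : Prop :=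
  (∃ (a : ℕ) (s : Multiset ℕ), p < a ∧ parts l = a ::ₘ s ∧ parts m = (a - p) ::ₘ s ∧
      (a - p ∈ s → p ∣ a)) ∨
  parts l = p ::ₘ parts m ∨
  (∃ a b : ℕ, a + b = p ∧ parts l = a ::ₘ b ::ₘ parts m)

/-- A `p`-bar core: a `p`-strict partition from which no `p`-bar can be removed. -/
def IsBarCore (p : ℕ) (l : YoungDiagram) : Prop :=
  IsPStrict p l ∧ ∀ m, ¬ RemovesBar p l m

/-- `RemovesBars p k l m`: `m` is obtained from `l` by removing `k` `p`-bars in succession. -/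
inductive RemovesBars (p : ℕ) : ℕ → YoungDiagram → YoungDiagram → Prop
  | refl (l : YoungDiagram) : RemovesBars p 0 l l
  | step {k : ℕ} {l m n : YoungDiagram} :
      RemovesBar p l m → RemovesBars p k m n → RemovesBars p (k + 1) l n

/-- The label `ρ^w` of a spin block: a `p`-bar core `ρ` and a weight `w`. -/
@[ext]
structure SpinBlock (p : ℕ) where
  core : YoungDiagram
  isBarCore : IsBarCore p core
  weight : ℕ

/-- The rank of `ρ^w`, that is, the `n` for which it labels blocks of the double covers of `S_n`
and `A_n`. -/
def SpinBlock.rank {p : ℕ} (B : SpinBlock p) : ℕ := B.core.card + p * B.weight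

/-- The `p`-strict partition `l` belongs to the block `B = ρ^w`: it has `p`-bar core `ρ`, reached
by removing `w` bars. -/
def SpinBlock.Contains {p : ℕ} (B : SpinBlock p) (l : YoungDiagram) : Prop :=
  IsPStrict p l ∧ RemovesBars p B.weight l B.core

/-- The entry `(ℓ_i, ε_i)` of the core tuple: `ℓ_i` is the number of beads on the runners `i` and
`p - i`, and `ε_i` is `0` if there is a bead on runner `i` and `1` otherwise. -/
def coreTuple (p : ℕ) (l : YoungDiagram) (i : ℕ) : ℕ × ℕ :=
  ((parts l).countP (fun a => a % p = i ∨ a % p = p - i),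
    if 0 < (parts l).countP (fun a => a % p = i) then 0 else 1)

/-! ### The crystal graph -/

/-- The residue of the nodes in column `s`; rows are filled with repetitions of
`0, 1, …, t - 1, t, t - 1, …, 1, 0`. -/
def res (p s : ℕ) : ℕ := min (s % p) (p - 1 - s % p)

/-- The partition `m` is obtained from the partition `l` by adding the node `A`. -/
def AddsNode (l : YoungDiagram) (A : ℕ × ℕ) (m : YoungDiagram) : Prop :=
  A ∉ l ∧ m.cells = insert A l.cells

/-- `A` is an `i`-removable node of `l`. -/
def IsRemovable (p i : ℕ) (l : YoungDiagram) (A : ℕ × ℕ) : Prop :=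
  res p A.2 = i ∧
    ((∃ m, IsPStrict p m ∧ AddsNode m A l) ∨
      (res p (A.2 + 1) = i ∧ ∃ m n, IsPStrict p m ∧ IsPStrict p n ∧
        AddsNode m (A.1, A.2 + 1) l ∧ AddsNode n A m))

/-- `B` is an `i`-addable node of `l`. -/
def IsAddable (p i : ℕ) (l : YoungDiagram) (B : ℕ × ℕ) : Prop :=
  res p B.2 = i ∧
    ((∃ m, IsPStrict p m ∧ AddsNode l B m) ∨
      (1 ≤ B.2 ∧ res p (B.2 - 1) = i ∧ ∃ m n, IsPStrict p m ∧ IsPStrict p n ∧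
        AddsNode l (B.1, B.2 - 1) m ∧ AddsNode m B n))

open Classical in
/-- The sign of a node: `true` is `+` (addable), `false` is `-` (removable). -/
noncomputable def nodeSign (p i : ℕ) (l : YoungDiagram) (A : ℕ × ℕ) :
    Option (Bool × (ℕ × ℕ)) :=
  if IsAddable p i l A then some (true, A)
  else if IsRemovable p i l A then some (false, A)
  else none

/-- The `i`-signature: the signs of all `i`-addable and `i`-removable nodes, read along the rim
from the bottom left to the top right. (Such nodes of row `r` lie in columns at most
`l.rowLen r + 1`, and only rows up to the first empty one can contain them.) -/
noncomputable def signature (p i : ℕ) (l : YoungDiagram) : List (Bool × (ℕ × ℕ)) :=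
  (List.range (l.colLen 0 + 1)).reverse.flatMap fun r =>
    (List.range (l.rowLen r + 2)).filterMap fun s => nodeSign p i l (r, s)

/-- One step of the reduction of a signature: the next sign is appended to what has been kept so
far (a list with the most recent sign first), unless it is a `-` that cancels with a `+` directly
before it. -/
def pushSign (kept : List (Bool × (ℕ × ℕ))) (x : Bool × (ℕ × ℕ)) : List (Bool × (ℕ × ℕ)) :=
  match kept, x with
  | (true, _) :: rest, (false, _) => rest
  | kept, x => x :: kept

/-- The reduced `i`-signature: all neighbouring pairs `+-` are erased successively. -/
noncomputable def reducedSignature (p i : ℕ) (l : YoungDiagram) : List (Bool × (ℕ × ℕ)) :=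
  ((signature p i l).foldl pushSign []).reverse

/-- `A` is the `i`-good node of `l`: the rightmost `-` of the reduced `i`-signature. -/
def IsGood (p i : ℕ) (l : YoungDiagram) (A : ℕ × ℕ) : Prop :=
  ((reducedSignature p i l).filter fun x => !x.1).getLast? = some (false, A)

/-- `A` is the `i`-cogood node of `l`: the leftmost `+` of the reduced `i`-signature. -/
def IsCogood (p i : ℕ) (l : YoungDiagram) (A : ℕ × ℕ) : Prop :=
  ((reducedSignature p i l).filter fun x => x.1).head? = some (true, A)

/-- There is an edge labelled `i` of the crystal graph from `l` up to `m`, both `p`-restricted. -/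
def CrystalEdge (p i : ℕ) (l m : YoungDiagram) : Prop :=
  IsPRestricted p l ∧ IsPRestricted p m ∧
    ∃ A, AddsNode l A m ∧ (IsCogood p i l A ∨ IsGood p i m A)

/-! ### The block-reduced crystal graph and the Scopes involutions -/

namespace SpinBlock

variable {p : ℕ}

/-- There is an edge labelled `i` of the block-reduced crystal graph from `B` up to `C` (whose rank
is one larger). -/
def Edge (i : ℕ) (B C : SpinBlock p) : Prop :=
  ∃ l m, B.Contains l ∧ C.Contains m ∧ CrystalEdge p i l m

/-- `B` lies at the maximal-rank end of its maximal `i`-string. -/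
def AtHighEnd (i : ℕ) (B : SpinBlock p) : Prop := ¬ ∃ C, Edge i B C

/-- `B` lies at the minimal-rank end of its maximal `i`-string. -/
def AtLowEnd (i : ℕ) (B : SpinBlock p) : Prop := ¬ ∃ C, Edge i C B

/-- `B` is an external block of its maximal `i`-string. -/
def IsExternal (i : ℕ) (B : SpinBlock p) : Prop := AtHighEnd i B ∨ AtLowEnd i B

end SpinBlock

/-- The Scopes involution `K_i` on `p`-strict partitions, in terms of the parts. For `1 ≤ i ≤ t` it
interchanges the runners `i` and `i + 1` and the runners `p - i` and `p - i - 1` (for `i = t`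
this is the single pair `t`, `t + 1`). `K_0` interchanges the beads `a p + 1` with `a ≥ 1` on
runner `1` with the beads `a p - 1` on runner `p - 1`, and removes the part `1` if it is present
and adds it otherwise. -/
def scopes (p i : ℕ) (s : Multiset ℕ) : Multiset ℕ :=
  if i = 0 then
    let s' := (s.erase 1).map fun a =>
      if a % p = 1 then a - 2 else if a % p = p - 1 then a + 2 else a
    if 1 ∈ s then s' else 1 ::ₘ s'
  else
    s.map fun a =>
      if a % p = i ∨ a % p = p - i - 1 then a + 1
      else if a % p = i + 1 ∨ a % p = p - i then a - 1
      else a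

namespace SpinBlock

variable {p : ℕ}

/-- `C = K_i B`: the core of `C` is `K_i` of the core of `B`, and the weights agree. -/
def IsScopesImage (i : ℕ) (B C : SpinBlock p) : Prop :=
  parts C.core = scopes p i (parts B.core) ∧ C.weight = B.weight

/-- `C` is obtained from `B` by an allowed action: some `K_i`, `0 ≤ i ≤ t`, where `B` is external
in its maximal `i`-string. -/
def AllowedAction (B C : SpinBlock p) : Prop :=
  ∃ i ≤ (p - 1) / 2, IsExternal i B ∧ IsScopesImage i B C

/-- `C` is obtained from `B` by a sequence of allowed actions. -/
def AllowedEquivalent (B C : SpinBlock p) : Prop := Relation.ReflTransGen AllowedAction B C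

/-- Some allowed action strictly lowers the rank of `B`. -/
def CanBeLowered (B : SpinBlock p) : Prop := ∃ C, AllowedAction B C ∧ C.rank < B.rank

end SpinBlock

end SpinCrystal

namespace SpinCrystal

/-! ### Young diagrams and their parts -/

/-! A block is encoded by its weight `w` and its labels `n_i` (`label`), the signed number of beads
of the core on the runners `i` and `p - i`. On a core the beads fill the lowest places of one runner
of each opposite pair, so the labels are arbitrary integers and determine the core
(`IsBarCore.mem_iff`, `exists_isBarCore`). The rank is a quadratic polynomial in them
(`two_mul_rank`). Charges survive the removal of bars, so membership in a block is a matter of size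
and charges (`contains_of_charge`).

An edge labelled `i` changes the charges by a fixed vector and the rank by one, so the rank formula
gives the weight of the upper block: `w - n_1` for `i = 0`, `w - 1 + n_i - n_{i+1}` for `0 < i < t`,
and `w - 2 + 2 n_t` for `i = t`. If this is negative, there is no edge upwards. Hence a block that
is at no high-rank end, or that cannot be lowered, satisfies `n_1 ≤ w`, `n_{i+1} ≤ n_i + w - 1` and
`1 - w ≤ 2 n_t`.

Completing the square with `z_i = 2 p n_i + 2 i - p` turns the rank into the sum of the `z_i ^ 2`,
up to scaling and a constant. With `c = 2 p (w - 1) + 2` the inequalities say that `z` starts at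
most at `c + p`, climbs by at most `c` per step and ends at least at `-c / 2`. The RoCK block is
`z_i = i c + p`, the unique maximiser of the sum of squares (`sum_sq_lt_of_steps`, by Hall's
theorem). This bounds the two classes of blocks, and lowering as long as possible bounds a
representative of each equivalence class.

For sharpness, allowed actions preserve a system of inequalities (`IsSeparated`) that holds for the
RoCK block: reflections permute the inequalities, except when the weight of the upper block is
exactly `0` for some `i < t`. In that case explicit crystal edges around the core of the upper block
show that the block is interior to its string, so the action is not allowed (`not_isExternal_zero`,
`not_isExternal_mid`). Separated blocks have `|z_i| ≥ c + p` with pairwise gaps at least `c`, so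
their rank is at least that of the RoCK block (`le_sum_sq_of_gaps`). The same explicit edges,
together with `not_atHighEnd_top`, show that the RoCK block is at no high-rank end. -/

theorem parts_eq_map (l : YoungDiagram) :
    parts l = (Multiset.range (l.colLen 0)).map l.rowLen := rfl

theorem zero_notMem_parts (l : YoungDiagram) : 0 ∉ parts l := fun h =>
  absurd (l.pos_of_mem_rowLens 0 h) (lt_irrefl 0)

theorem rowLen_pos_iff (l : YoungDiagram) (r : ℕ) : 0 < l.rowLen r ↔ r < l.colLen 0 := by
  rw [← YoungDiagram.mem_iff_lt_rowLen, YoungDiagram.mem_iff_lt_colLen]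

theorem mem_parts_iff {l : YoungDiagram} {a : ℕ} : a ∈ parts l ↔ 0 < a ∧ ∃ r, l.rowLen r = a := by
  rw [parts_eq_map, Multiset.mem_map]
  constructor
  · rintro ⟨r, hr, rfl⟩
    exact ⟨(rowLen_pos_iff l r).2 (Multiset.mem_range.1 hr), r, rfl⟩
  · rintro ⟨h, r, rfl⟩
    exact ⟨r, Multiset.mem_range.2 ((rowLen_pos_iff l r).1 h), rfl⟩

theorem parts_injective {l m : YoungDiagram} (h : parts l = parts m) : l = m := by
  have h1 : l.rowLens = m.rowLens :=
    List.Perm.eq_of_pairwise' (r := (· ≥ ·)) l.rowLens_sorted.pairwise m.rowLens_sorted.pairwise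
      (Multiset.coe_eq_coe.1 h)
  exact YoungDiagram.equivListRowLens.injective (Subtype.ext h1)

theorem exists_parts_eq {s : Multiset ℕ} (h : 0 ∉ s) : ∃ l : YoungDiagram, parts l = s := by
  have hs : (s.sort (· ≥ ·)).SortedGE := (Multiset.pairwise_sort s (· ≥ ·)).sortedGE
  have hpos : ∀ x ∈ s.sort (· ≥ ·), 0 < x := fun x hx =>
    Nat.pos_of_ne_zero fun h0 => h (h0 ▸ (Multiset.mem_sort (· ≥ ·)).1 hx)
  refine ⟨YoungDiagram.ofRowLens _ hs, ?_⟩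
  rw [parts, YoungDiagram.rowLens_ofRowLens_eq_self hpos, Multiset.sort_eq]

theorem sum_map_parts {R : Type*} [AddCommMonoid R] (f : ℕ → R) (hf : f 0 = 0)
    (l : YoungDiagram) {M : ℕ} (hM : l.colLen 0 ≤ M) :
    ((parts l).map f).sum = ∑ r ∈ Finset.range M, f (l.rowLen r) := by
  rw [parts_eq_map, Multiset.map_map]
  refine (Finset.sum_subset (Finset.range_subset_range.2 hM) fun r _ hr => ?_)
  have : l.rowLen r = 0 := by
    have := rowLen_pos_iff l r
    simp at hr; omega
  rw [Function.comp_apply, this, hf]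

theorem card_eq_sum_parts (l : YoungDiagram) : l.card = (parts l).sum := by
  have h1 := sum_map_parts (R := ℕ) id rfl l le_rfl
  rw [Multiset.map_id] at h1
  rw [h1, YoungDiagram.card, Finset.card_eq_sum_card_fiberwise (f := Prod.fst)
    (t := Finset.range (l.colLen 0))]
  · exact Finset.sum_congr rfl fun r _ => (l.rowLen_eq_card).symm
  · rintro ⟨r, s⟩ h
    have h2 : (r, s) ∈ l := h
    rw [YoungDiagram.mem_iff_lt_rowLen] at h2
    simpa using (rowLen_pos_iff l r).1 (by omega)

theorem isPStrict_iff {p : ℕ} {l : YoungDiagram} :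
    IsPStrict p l ↔ ∀ a, 2 ≤ (parts l).count a → p ∣ a := by
  constructor
  · intro h a ha
    have h0 : 0 < a := (mem_parts_iff.1 (Multiset.count_pos.1 (by omega : 0 < (parts l).count a))).1
    rw [parts_eq_map, Multiset.count_map, ] at ha
    have h2 : 1 < (Finset.filter (fun r => a = l.rowLen r) (Finset.range (l.colLen 0))).card := ha
    obtain ⟨r, hr, r', hr', hne⟩ := Finset.one_lt_card.1 h2
    simp only [Finset.mem_filter] at hr hr'
    have key : ∀ r r', r < r' → a = l.rowLen r → a = l.rowLen r' → p ∣ a := by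
      intro r r' hlt e1 e2
      have h3 := l.rowLen_anti r (r + 1) (by omega)
      have h4 := l.rowLen_anti (r + 1) r' (by omega)
      rw [e1]
      exact h r (by omega)
    rcases lt_or_gt_of_ne hne with hlt | hlt
    · exact key _ _ hlt hr.2 hr'.2
    · exact key _ _ hlt hr'.2 hr.2
  · intro h r hr
    rcases Nat.eq_zero_or_pos (l.rowLen r) with h0 | h0
    · rw [h0]; exact dvd_zero p
    · refine h _ ?_
      rw [parts_eq_map, Multiset.count_map]
      change 1 < (Finset.filter (fun r' => l.rowLen r = l.rowLen r')
        (Finset.range (l.colLen 0))).card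
      refine Finset.one_lt_card.2 ⟨r, ?_, r + 1, ?_, by omega⟩
      · simpa using (rowLen_pos_iff l r).1 h0
      · simpa [hr] using (rowLen_pos_iff l (r + 1)).1 (hr ▸ h0)

theorem isPStrict_of_nodup {p : ℕ} {l : YoungDiagram} (h : (parts l).Nodup) : IsPStrict p l :=
  isPStrict_iff.2 fun a ha => absurd (Multiset.nodup_iff_count_le_one.1 h a) (by omega)

/-- If all parts of `l` are distinct, its nonempty rows have distinct lengths. -/
theorem rowLen_lt_of_nodup {l : YoungDiagram} (h : (parts l).Nodup) {r r' : ℕ} (hr : r < r')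
    (h0 : 0 < l.rowLen r) : l.rowLen r' < l.rowLen r := by
  have h1 := l.rowLen_anti r (r + 1) (by omega)
  have h2 := l.rowLen_anti (r + 1) r' (by omega)
  refine lt_of_le_of_lt h2 (lt_of_le_of_ne h1 fun h3 => ?_)
  have h4 : IsPStrict (l.rowLen r + 1) l := isPStrict_of_nodup h
  have := Nat.le_of_dvd h0 (h4 r h3.symm)
  omega

theorem rowLen_injective_of_nodup {l : YoungDiagram} (h : (parts l).Nodup) {r r' : ℕ}
    (h0 : 0 < l.rowLen r) (he : l.rowLen r = l.rowLen r') : r = r' := by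
  rcases lt_trichotomy r r' with hr | hr | hr
  · have := rowLen_lt_of_nodup h hr h0; omega
  · exact hr
  · have := rowLen_lt_of_nodup h hr (he ▸ h0); omega

theorem AddsNode.rowLen {l m : YoungDiagram} {r s : ℕ} (h : AddsNode l (r, s) m) :
    l.rowLen r = s ∧ m.rowLen r = s + 1 ∧ ∀ r', r' ≠ r → m.rowLen r' = l.rowLen r' := by
  obtain ⟨h1, h2⟩ := h
  have hm : ∀ r' s', s' < m.rowLen r' ↔ (r' = r ∧ s' = s) ∨ s' < l.rowLen r' := by
    intro r' s'
    rw [← YoungDiagram.mem_iff_lt_rowLen, ← YoungDiagram.mem_iff_lt_rowLen,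
      ← YoungDiagram.mem_cells, h2, Finset.mem_insert, Prod.mk.injEq, YoungDiagram.mem_cells]
  have hs : ¬ s < l.rowLen r := by rwa [YoungDiagram.mem_iff_lt_rowLen] at h1
  have a1 := (hm r s).2 (Or.inl ⟨rfl, rfl⟩)
  have a2 : l.rowLen r = s := by
    by_contra hne
    have := (hm r (l.rowLen r)).1 (by omega)
    omega
  refine ⟨a2, ?_, fun r' hr' => ?_⟩
  · have := (hm r (s + 1)).1
    omega
  · have b1 := hm r' (m.rowLen r')
    have b2 := hm r' (l.rowLen r')
    omega

/-- Only one row changes. Both the charges and the multiplicities of parts are sums of this kind, so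
this identity controls either of them under the addition of a node. -/
theorem AddsNode.sum_map {R : Type*} [AddCommGroup R] {l m : YoungDiagram} {r s : ℕ}
    (h : AddsNode l (r, s) m) (f : ℕ → R) (hf : f 0 = 0) :
    ((parts m).map f).sum = ((parts l).map f).sum + (f (s + 1) - f s) := by
  obtain ⟨h1, h2, h3⟩ := h.rowLen
  set M := max (max (l.colLen 0) (m.colLen 0)) (r + 1)
  rw [sum_map_parts f hf l (M := M) (by omega), sum_map_parts f hf m (M := M) (by omega),
    ← Finset.add_sum_erase _ _ (Finset.mem_range.2 (by omega : r < M)),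
    ← Finset.add_sum_erase _ (fun r => f (l.rowLen r)) (Finset.mem_range.2 (by omega : r < M)),
    Finset.sum_congr rfl fun r' hr' => by rw [h3 r' (Finset.ne_of_mem_erase hr')], h1, h2]
  abel

theorem AddsNode.card {l m : YoungDiagram} {A : ℕ × ℕ} (h : AddsNode l A m) :
    m.card = l.card + 1 := by
  rw [YoungDiagram.card, h.2, Finset.card_insert_of_notMem h.1]

theorem AddsNode.count {l m : YoungDiagram} {r s : ℕ} (h : AddsNode l (r, s) m) {x : ℕ}
    (hx : 0 < x) : ((parts m).count x : ℤ) =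
      (parts l).count x + ((if x = s + 1 then 1 else 0) - (if x = s then 1 else 0)) := by
  have key : ∀ k : YoungDiagram,
      ((parts k).map fun a => if x = a then (1 : ℤ) else 0).sum = (parts k).count x := by
    intro k
    induction parts k using Multiset.induction with
    | empty => simp
    | cons a s ih => rw [Multiset.map_cons, Multiset.sum_cons, ih, Multiset.count_cons]; simp; ring
  have := h.sum_map (fun a => if x = a then (1 : ℤ) else 0) (if_neg (by omega))
  rwa [key, key] at this

theorem exists_addsNode {l : YoungDiagram} {r : ℕ}
    (h : ∀ r', r = r' + 1 → l.rowLen r < l.rowLen r') :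
    ∃ m, AddsNode l (r, l.rowLen r) m := by
  have hn : (r, l.rowLen r) ∉ l := by simp [YoungDiagram.mem_iff_lt_rowLen]
  refine ⟨⟨insert (r, l.rowLen r) l.cells, ?_⟩, hn, rfl⟩
  rintro ⟨r1, s1⟩ ⟨r2, s2⟩ hle hmem
  obtain ⟨hr, hs⟩ := Prod.mk_le_mk.1 hle
  simp only [Finset.coe_insert, Set.mem_insert_iff, Prod.mk.injEq, Finset.mem_coe,
    YoungDiagram.mem_cells, YoungDiagram.mem_iff_lt_rowLen] at hmem ⊢
  rcases hmem with ⟨rfl, rfl⟩ | hmem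
  · rcases Nat.lt_or_ge r2 r1 with hlt | hge
    · right
      have h1 := h (r1 - 1) (by omega)
      have h2 := l.rowLen_anti r2 (r1 - 1) (by omega)
      omega
    · have : r2 = r1 := by omega
      subst this
      omega
  · right
    have := l.rowLen_anti r2 r1 hr
    omega

theorem exists_removesNode {m : YoungDiagram} {r s : ℕ} (h : m.rowLen r = s + 1)
    (h' : m.rowLen (r + 1) ≤ s) : ∃ l, AddsNode l (r, s) m := by
  have hmem : (r, s) ∈ m.cells := by
    rw [YoungDiagram.mem_cells, YoungDiagram.mem_iff_lt_rowLen]; omega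
  refine ⟨⟨m.cells.erase (r, s), ?_⟩, ?_, ?_⟩
  · rintro ⟨r1, s1⟩ ⟨r2, s2⟩ hle hmem'
    obtain ⟨hr, hs⟩ := Prod.mk_le_mk.1 hle
    simp only [Finset.coe_erase, Set.mem_sdiff, Finset.mem_coe, Set.mem_singleton_iff,
      Prod.mk.injEq, YoungDiagram.mem_cells, YoungDiagram.mem_iff_lt_rowLen] at hmem' ⊢
    have h1 := m.rowLen_anti r2 r1 hr
    refine ⟨by omega, ?_⟩
    rintro ⟨rfl, rfl⟩
    rcases Nat.lt_or_ge r2 r1 with hlt | hge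
    · have := m.rowLen_anti (r2 + 1) r1 (by omega)
      omega
    · have : r1 = r2 := by omega
      subst this
      omega
  · exact fun h => Finset.notMem_erase (r, s) m.cells h
  · exact (Finset.insert_erase hmem).symm

/-! ### Charges -/

/-- The contribution of a part `a` to the charge of runner `r`: beads on runner `r` count `1`,
those on the opposite runner `p - r` count `-1`. -/
def beadCharge (p a r : ℕ) : ℤ :=
  (if a % p = r then 1 else 0) - (if a % p = (p - r) % p then 1 else 0)

/-- The charge of runner `r`: the number of beads on it minus the number on the opposite one. -/
def charge (p : ℕ) (s : Multiset ℕ) (r : ℕ) : ℤ := (s.map fun a => beadCharge p a r).sum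

variable {p t : ℕ}

theorem beadCharge_zero {r : ℕ} (hr : r < p) : beadCharge p 0 r = 0 := by
  rcases Nat.eq_zero_or_pos r with rfl | h
  · simp [beadCharge]
  · have : (p - r) % p = p - r := Nat.mod_eq_of_lt (by omega)
    rw [beadCharge, this]
    split_ifs with h1 h2 h2 <;> simp only [Nat.zero_mod] at * <;> omega

theorem beadCharge_congr {a b : ℕ} (h : a % p = b % p) (r : ℕ) :
    beadCharge p a r = beadCharge p b r := by simp [beadCharge, h]

theorem beadCharge_mod (a r : ℕ) : beadCharge p (a % p) r = beadCharge p a r :=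
  beadCharge_congr (Nat.mod_mod a p) r

/-- As a function of the residue of `a`, the bead charge is odd. -/
theorem beadCharge_add {a b r : ℕ} (hp : 0 < p) (h : (a + b) % p = 0) (hr : r < p) :
    beadCharge p a r + beadCharge p b r = 0 := by
  rw [← beadCharge_mod a, ← beadCharge_mod b]
  rw [Nat.add_mod] at h
  have ha := Nat.mod_lt a hp
  have hb := Nat.mod_lt b hp
  generalize a % p = x at *
  generalize b % p = y at *
  have hxy : x + y = 0 ∨ x + y = p := by
    rcases Nat.lt_or_ge (x + y) p with h1 | h1
    · rw [Nat.mod_eq_of_lt h1] at h; exact Or.inl h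
    · have h2 : (x + y - p) % p = 0 := by rw [← Nat.mod_eq_sub_mod h1]; exact h
      rw [Nat.mod_eq_of_lt (by omega)] at h2
      right; omega
  have hr' : (p - r) % p = if r = 0 then 0 else p - r := by
    split_ifs with h0
    · simp [h0]
    · exact Nat.mod_eq_of_lt (by omega)
  simp only [beadCharge, Nat.mod_eq_of_lt ha, Nat.mod_eq_of_lt hb, hr']
  split_ifs <;> omega

theorem charge_cons (a : ℕ) (s : Multiset ℕ) (r : ℕ) :
    charge p (a ::ₘ s) r = beadCharge p a r + charge p s r := by
  simp [charge]

theorem charge_eq_countP (s : Multiset ℕ) (r : ℕ) : charge p s r =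
    s.countP (fun a => a % p = r) - s.countP (fun a => a % p = (p - r) % p) := by
  induction s using Multiset.induction with
  | empty => simp [charge]
  | cons a s ih =>
    rw [charge_cons, ih, Multiset.countP_cons, Multiset.countP_cons, beadCharge]
    push_cast
    ring

theorem charge_zero (s : Multiset ℕ) : charge p s 0 = 0 := by
  simp [charge_eq_countP]

theorem charge_sub {r : ℕ} (h0 : 0 < r) (hr : r < p) (s : Multiset ℕ) :
    charge p s (p - r) = - charge p s r := by
  rw [charge_eq_countP, charge_eq_countP, Nat.sub_sub_self hr.le, Nat.mod_eq_of_lt hr,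
    Nat.mod_eq_of_lt (by omega : p - r < p)]
  ring

/-! ### Removing bars -/

theorem RemovesBar.sum {l m : YoungDiagram} (h : RemovesBar p l m) :
    (parts l).sum = (parts m).sum + p := by
  rcases h with ⟨a, s, ha, h1, h2, -⟩ | h | ⟨a, b, hab, h⟩
  · rw [h1, h2]; simp; omega
  · rw [h]; simp; omega
  · rw [h]; simp; omega

theorem RemovesBar.card {l m : YoungDiagram} (h : RemovesBar p l m) : l.card = m.card + p := by
  rw [card_eq_sum_parts, card_eq_sum_parts, h.sum]

/-- Lowering a part keeps it on its runner, a part `p` carries no charge, and two parts with sum `p`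
have opposite charges. -/
theorem RemovesBar.charge {l m : YoungDiagram} (h : RemovesBar p l m) (hp : 0 < p) {r : ℕ}
    (hr : r < p) : charge p (parts m) r = charge p (parts l) r := by
  rcases h with ⟨a, s, ha, h1, h2, -⟩ | h | ⟨a, b, hab, h⟩
  · rw [h1, h2, charge_cons, charge_cons, beadCharge_congr (Nat.mod_eq_sub_mod ha.le)]
  · rw [h, charge_cons, beadCharge_congr (b := 0) (by simp), beadCharge_zero hr, zero_add]
  · rw [h, charge_cons, charge_cons, ← add_assoc, beadCharge_add hp (by simp [hab]) hr, zero_add]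

theorem RemovesBar.isPStrict {l m : YoungDiagram} (h : RemovesBar p l m) (hl : IsPStrict p l) :
    IsPStrict p m := by
  rw [isPStrict_iff] at hl ⊢
  intro x hx
  rcases h with ⟨a, s, ha, h1, h2, h3⟩ | h | ⟨a, b, hab, h⟩
  · rw [h2, Multiset.count_cons] at hx
    have h4 := hl x
    rw [h1, Multiset.count_cons] at h4
    split_ifs at hx h4 with h5 h6
    · exact h4 (by omega)
    · have h7 : a - p ∈ s := by
        rw [← h5]; exact Multiset.count_pos.1 (by omega)
      rw [h5]
      exact Nat.dvd_sub (h3 h7) dvd_rfl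
    · exact h4 (by omega)
    · exact h4 (by omega)
  · refine hl x (hx.trans ?_)
    rw [h]; exact Multiset.count_le_count_cons _ _ _
  · refine hl x (hx.trans ?_)
    rw [h]
    exact (Multiset.count_le_count_cons _ _ _).trans (Multiset.count_le_count_cons _ _ _)

theorem RemovesBars.card {k : ℕ} {l m : YoungDiagram} (h : RemovesBars p k l m) :
    l.card = m.card + p * k := by
  induction h with
  | refl => simp
  | step h1 _ ih => rw [h1.card, ih]; ring

theorem RemovesBars.charge {k : ℕ} {l m : YoungDiagram} (h : RemovesBars p k l m) (hp : 0 < p)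
    {r : ℕ} (hr : r < p) : charge p (parts m) r = charge p (parts l) r := by
  induction h with
  | refl => rfl
  | step h1 _ ih => rw [ih, h1.charge hp hr]

/-- Each bar removed lowers the size by `p`, so removal terminates. This supplies the block at the
far end of a crystal edge. -/
theorem exists_contains (hp : 0 < p) {l : YoungDiagram} (hl : IsPStrict p l) :
    ∃ B : SpinBlock p, B.Contains l := by
  induction hn : l.card using Nat.strong_induction_on generalizing l with
  | _ n ih =>
    by_cases h : IsBarCore p l
    · exact ⟨⟨l, h, 0⟩, hl, RemovesBars.refl l⟩
    · obtain ⟨m, hm⟩ : ∃ m, RemovesBar p l m := by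
        by_contra hc
        exact h ⟨hl, not_exists.1 hc⟩
      obtain ⟨B, h1, h2⟩ := ih m.card (by rw [← hn, hm.card]; omega) (hm.isPStrict hl) rfl
      exact ⟨⟨B.core, B.isBarCore, B.weight + 1⟩, hl, RemovesBars.step hm h2⟩

/-! ### Cores -/

namespace IsBarCore

variable {l : YoungDiagram}

/-- Repetitions are permitted on runner `0`, so a part there can always be lowered, or deleted if it
is `p`. -/
theorem not_dvd (h : IsBarCore p l) {a : ℕ} (ha : a ∈ parts l) : ¬ p ∣ a := by
  intro hd
  obtain ⟨s, hs⟩ := Multiset.exists_cons_of_mem ha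
  have h0 : 0 < a := (mem_parts_iff.1 ha).1
  have h0s : 0 ∉ s := fun h0 => zero_notMem_parts l (hs ▸ Multiset.mem_cons_of_mem h0)
  rcases (Nat.le_of_dvd h0 hd).eq_or_lt with h1 | h1
  · obtain ⟨m, hm⟩ := exists_parts_eq h0s
    exact h.2 m (Or.inr (Or.inl (by rw [hm, hs, h1])))
  · obtain ⟨m, hm⟩ := exists_parts_eq (s := (a - p) ::ₘ s) (by
      rw [Multiset.mem_cons, not_or]; exact ⟨by omega, h0s⟩)
    exact h.2 m (Or.inl ⟨a, s, h1, hs, hm, fun _ => hd⟩)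

theorem nodup (h : IsBarCore p l) : (parts l).Nodup := by
  rw [Multiset.nodup_iff_count_le_one]
  intro a
  by_contra hc
  exact h.not_dvd (Multiset.count_pos.1 (by omega : 0 < (parts l).count a))
    (isPStrict_iff.1 h.1 a (by omega))

theorem sub_mem (h : IsBarCore p l) {a : ℕ} (ha : a ∈ parts l) (hap : p < a) :
    a - p ∈ parts l := by
  by_contra hc
  obtain ⟨s, hs⟩ := Multiset.exists_cons_of_mem ha
  obtain ⟨m, hm⟩ := exists_parts_eq (s := (a - p) ::ₘ s) (by
    rw [Multiset.mem_cons, not_or]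
    exact ⟨by omega, fun h0 => zero_notMem_parts l (hs ▸ Multiset.mem_cons_of_mem h0)⟩)
  exact h.2 m (Or.inl ⟨a, s, hap, hs, hm, fun h1 => absurd (hs ▸ Multiset.mem_cons_of_mem h1) hc⟩)

theorem add_ne (h : IsBarCore p l) {a b : ℕ} (ha : a ∈ parts l) (hb : b ∈ parts l)
    (hp : p % 2 = 1) : a + b ≠ p := by
  intro hab
  obtain ⟨s, hs⟩ := Multiset.exists_cons_of_mem ha
  have hbs : b ∈ s := by
    rw [hs, Multiset.mem_cons] at hb
    -- Since `p` is odd, `a ≠ b`: the two parts are distinct members of the multiset.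
    exact hb.resolve_left (by omega)
  obtain ⟨u, hu⟩ := Multiset.exists_cons_of_mem hbs
  obtain ⟨m, hm⟩ := exists_parts_eq (s := u) fun h0 => zero_notMem_parts l (by
    rw [hs, hu]; exact Multiset.mem_cons_of_mem (Multiset.mem_cons_of_mem h0))
  exact h.2 m (Or.inr (Or.inr ⟨a, b, hab, by rw [hs, hu, hm]⟩))

theorem mod_mem (h : IsBarCore p l) {a k : ℕ} (ha : a ∈ parts l) (hk : k ≤ a / p) :
    a % p + p * k ∈ parts l := by
  have hdiv := Nat.mod_add_div a p
  obtain ⟨d, hd⟩ := Nat.exists_eq_add_of_le hk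
  induction d generalizing k with
  | zero => rw [show k = a / p by omega, hdiv]; exact ha
  | succ d ih =>
    have h1 := ih (k := k + 1) (by omega) (by omega)
    have h2 : a % p ≠ 0 := fun h0 => h.not_dvd ha (Nat.dvd_of_mod_eq_zero h0)
    have h3 := h.sub_mem h1 (by
      rw [Nat.mul_succ]
      generalize a % p = x at h2
      generalize p * k = y
      omega)
    rwa [show a % p + p * (k + 1) - p = a % p + p * k by
      rw [Nat.mul_succ, ← Nat.add_assoc, Nat.add_sub_cancel]] at h3

/-- On each runner, the beads of a core occupy the first places; their number is the charge. -/
theorem mem_iff (h : IsBarCore p l) (hp : p % 2 = 1) (a : ℕ) :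
    a ∈ parts l ↔ ((a / p : ℕ) : ℤ) < charge p (parts l) (a % p) := by
  have hp0 : 0 < p := by omega
  have hlt := Nat.mod_lt a hp0
  set r := a % p with hr
  set k := a / p with hk
  have hdiv : r + p * k = a := Nat.mod_add_div a p
  have hmod : ∀ j, (r + p * j) % p = r := fun j => by
    rw [Nat.add_mul_mod_self_left]; exact Nat.mod_eq_of_lt hlt
  have hdv : ∀ j, (r + p * j) / p = j := fun j => by
    rw [Nat.add_mul_div_left _ _ hp0, Nat.div_eq_of_lt hlt, zero_add]
  rcases Nat.eq_zero_or_pos r with h0 | h0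
  · rw [h0, charge_zero]
    refine iff_of_false (fun ha => h.not_dvd ha (Nat.dvd_of_mod_eq_zero h0))
      (not_lt.2 (Int.natCast_nonneg k))
  set T := (parts l).toFinset.filter (fun b => b % p = r) with hT
  have hcount : (parts l).countP (fun b => b % p = r) = T.card := by
    rw [Multiset.countP_eq_card_filter, hT, Finset.card, Finset.filter_val,
      Multiset.toFinset_val, Multiset.dedup_eq_self.2 h.nodup]
  have hmemT : ∀ b, b ∈ T ↔ b ∈ parts l ∧ b % p = r := by simp [hT]
  -- Beads on both opposite runners would force beads at the lowest places `r` and `p - r`, whose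
  -- sum is `p`.
  have hopp : T.Nonempty → (parts l).countP (fun b => b % p = (p - r) % p) = 0 := by
    rintro ⟨b, hb⟩
    rw [Multiset.countP_eq_zero]
    intro c hc hcr
    rw [hmemT] at hb
    have h1 := h.mod_mem hb.1 (Nat.zero_le _)
    have h2 := h.mod_mem hc (Nat.zero_le _)
    rw [hb.2] at h1
    rw [hcr, Nat.mod_eq_of_lt (by omega)] at h2
    exact h.add_ne h1 h2 hp (by rw [Nat.mul_zero]; omega)
  rw [charge_eq_countP, hcount]
  constructor
  · intro ha
    rw [hopp ⟨a, (hmemT a).2 ⟨ha, rfl⟩⟩]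
    have : (Finset.range (k + 1)).image (fun j => r + p * j) ⊆ T := by
      intro b hb
      obtain ⟨j, hj, rfl⟩ := Finset.mem_image.1 hb
      rw [Finset.mem_range] at hj
      exact (hmemT _).2 ⟨h.mod_mem ha (by omega), hmod j⟩
    have h1 := Finset.card_le_card this
    rw [Finset.card_image_of_injective _ (fun x y hxy => by
      have := congrArg (· / p) hxy
      simpa [hdv] using this), Finset.card_range] at h1
    omega
  · intro hlt'
    by_contra ha
    have : T ⊆ (Finset.range k).image (fun j => r + p * j) := by
      intro b hb
      rw [hmemT] at hb
      refine Finset.mem_image.2 ⟨b / p, ?_, by rw [← hb.2, Nat.mod_add_div]⟩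
      rw [Finset.mem_range]
      by_contra hge
      have h1 := h.mod_mem hb.1 (not_lt.1 hge)
      rw [hb.2, hdiv] at h1
      exact ha h1
    have h1 := (Finset.card_le_card this).trans Finset.card_image_le
    rw [Finset.card_range] at h1
    omega

theorem eq_of_charge_eq {m : YoungDiagram} (hl : IsBarCore p l) (hm : IsBarCore p m)
    (hp : p % 2 = 1) (h : ∀ r < p, charge p (parts l) r = charge p (parts m) r) : l = m := by
  refine parts_injective ((Multiset.Nodup.ext hl.nodup hm.nodup).2 fun a => ?_)
  rw [hl.mem_iff hp, hm.mem_iff hp, h _ (Nat.mod_lt a (by omega))]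

end IsBarCore

/-! ### Blocks in terms of size and charges -/

theorem SpinBlock.Contains.card {B : SpinBlock p} {l : YoungDiagram} (h : B.Contains l) :
    l.card = B.rank := h.2.card

theorem SpinBlock.Contains.charge {B : SpinBlock p} {l : YoungDiagram} (h : B.Contains l)
    (hp : 0 < p) {r : ℕ} (hr : r < p) :
    charge p (parts l) r = charge p (parts B.core) r := (h.2.charge hp hr).symm

/-- A block consists of the `p`-strict partitions of its rank with the charges of its core. -/
theorem SpinBlock.contains_of_charge {B : SpinBlock p} {l : YoungDiagram} (hp : p % 2 = 1)
    (hl : IsPStrict p l) (hc : l.card = B.rank)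
    (h : ∀ r < p, SpinCrystal.charge p (parts l) r = SpinCrystal.charge p (parts B.core) r) :
    B.Contains l := by
  obtain ⟨C, hC⟩ := exists_contains (by omega : 0 < p) hl
  have h1 : C.core = B.core := C.isBarCore.eq_of_charge_eq B.isBarCore hp fun r hr => by
    rw [← hC.charge (by omega) hr, h r hr]
  have h2 := hC.card
  rw [hc, rank, rank, h1] at h2
  have h3 : C.weight = B.weight := Nat.eq_of_mul_eq_mul_left (by omega : 0 < p) (by omega)
  have h4 : C = B := SpinBlock.ext h1 h3
  exact h4 ▸ hC

/-! ### Cores with prescribed charges -/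

/-- The functions that are the charges of some core. -/
def IsCharge (p : ℕ) (N : ℕ → ℤ) : Prop := N 0 = 0 ∧ ∀ r, 0 < r → r < p → N (p - r) = - N r

theorem isCharge_charge (s : Multiset ℕ) : IsCharge p (charge p s) :=
  ⟨charge_zero s, fun _ h0 hr => charge_sub h0 hr s⟩

theorem isCharge_beadCharge (a : ℕ) : IsCharge p (beadCharge p a) := by
  have h : beadCharge p a = charge p {a} := by ext r; simp [charge]
  exact h ▸ isCharge_charge _

theorem IsCharge.add {M N : ℕ → ℤ} (hM : IsCharge p M) (hN : IsCharge p N) :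
    IsCharge p fun r => M r + N r :=
  ⟨by simp [hM.1, hN.1], fun r h0 hr => by simp only [hM.2 r h0 hr, hN.2 r h0 hr]; ring⟩

theorem IsCharge.neg {N : ℕ → ℤ} (hN : IsCharge p N) : IsCharge p fun r => - N r :=
  ⟨by simp [hN.1], fun r h0 hr => by simp only [hN.2 r h0 hr]⟩

theorem IsCharge.ext {M N : ℕ → ℤ} (hM : IsCharge p M) (hN : IsCharge p N)
    (hpt : p = 2 * t + 1) (h : ∀ i, 1 ≤ i → i ≤ t → M i = N i) {r : ℕ} (hr : r < p) :
    M r = N r := by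
  rcases Nat.eq_zero_or_pos r with rfl | h0
  · rw [hM.1, hN.1]
  rcases Nat.lt_or_ge t r with h1 | h1
  · have h2 := hM.2 (p - r) (by omega) (by omega)
    have h3 := hN.2 (p - r) (by omega) (by omega)
    rw [Nat.sub_sub_self hr.le] at h2 h3
    rw [h2, h3, h _ (by omega) (by omega)]
  · exact h r h0 h1

/-- The beads of the core with charges `N`. -/
def beadSet (p : ℕ) (N : ℕ → ℤ) : Finset ℕ :=
  (Finset.range p).biUnion fun r => (Finset.range (N r).toNat).image fun j => r + p * j

theorem mem_beadSet (hp : 0 < p) {N : ℕ → ℤ} {a : ℕ} :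
    a ∈ beadSet p N ↔ ((a / p : ℕ) : ℤ) < N (a % p) := by
  simp only [beadSet, Finset.mem_biUnion, Finset.mem_image, Finset.mem_range]
  constructor
  · rintro ⟨r, hr, j, hj, rfl⟩
    rw [Nat.add_mul_mod_self_left, Nat.mod_eq_of_lt hr, Nat.add_mul_div_left _ _ hp,
      Nat.div_eq_of_lt hr, zero_add]
    omega
  · intro h
    exact ⟨a % p, Nat.mod_lt a hp, a / p, by omega, Nat.mod_add_div a p⟩

/-- Each runner `r` with `N r > 0` receives beads in its `N r` lowest places. Antisymmetry of `N`
leaves the opposite runner empty, so no two parts add up to `p`. -/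
theorem exists_isBarCore (hp : p % 2 = 1) {N : ℕ → ℤ} (hN : IsCharge p N) :
    ∃ l, IsBarCore p l ∧ ∀ r < p, charge p (parts l) r = N r := by
  have hp0 : 0 < p := by omega
  have hmem := fun a => mem_beadSet hp0 (N := N) (a := a)
  have hmod : ∀ a ∈ beadSet p N, ¬ p ∣ a := fun a ha hd => by
    rw [hmem, Nat.mod_eq_zero_of_dvd hd, hN.1] at ha
    exact absurd ha (not_lt.2 (Int.natCast_nonneg _))
  obtain ⟨l, hl⟩ := exists_parts_eq (s := (beadSet p N).val) fun h => hmod 0 h (dvd_zero p)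
  have hcore : IsBarCore p l := by
    refine ⟨isPStrict_of_nodup (hl ▸ (beadSet p N).nodup), fun m hm => ?_⟩
    rcases hm with ⟨a, s, ha, h1, -, h3⟩ | h | ⟨a, b, hab, h⟩
    · rw [hl] at h1
      have ha1 : a ∈ beadSet p N := by
        rw [← Finset.mem_val, h1]; exact Multiset.mem_cons_self a s
      refine hmod a ha1 (h3 ?_)
      have ha2 : a - p ∈ beadSet p N := by
        rw [hmem] at ha1 ⊢
        rw [Nat.mod_eq_sub_mod ha.le, Nat.div_eq_sub_div hp0 ha.le] at ha1
        push_cast at ha1 ⊢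
        omega
      rw [← Finset.mem_val, h1, Multiset.mem_cons] at ha2
      exact ha2.resolve_left (by omega)
    · refine hmod p ?_ dvd_rfl
      rw [← Finset.mem_val, ← hl, h]; exact Multiset.mem_cons_self _ _
    · have ha : a ∈ beadSet p N := by
        rw [← Finset.mem_val, ← hl, h]; exact Multiset.mem_cons_self _ _
      have hb : b ∈ beadSet p N := by
        rw [← Finset.mem_val, ← hl, h]
        exact Multiset.mem_cons_of_mem (Multiset.mem_cons_self _ _)
      have ha0 : a ≠ 0 := fun h0 => hmod a ha (h0 ▸ dvd_zero p)
      have hb0 : b ≠ 0 := fun h0 => hmod b hb (h0 ▸ dvd_zero p)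
      rw [hmem, Nat.mod_eq_of_lt (by omega), Nat.div_eq_of_lt (by omega)] at ha hb
      have h4 := hN.2 a (by omega) (by omega)
      rw [show p - a = b by omega] at h4
      omega
  refine ⟨l, hcore, fun r hr => ?_⟩
  rcases Nat.eq_zero_or_pos r with rfl | h0
  · rw [charge_zero, hN.1]
  -- The beads of a single runner reveal only the positive part of its charge; the opposite runner
  -- supplies the negative part.
  have key : ∀ r < p, (charge p (parts l) r).toNat = (N r).toNat := by
    intro r hr
    refine eq_of_forall_lt_iff fun j => ?_
    have h1 := hcore.mem_iff hp (r + p * j)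
    have h2 := hmem (r + p * j)
    rw [hl, Finset.mem_val, h2, Nat.add_mul_mod_self_left, Nat.mod_eq_of_lt hr,
      Nat.add_mul_div_left _ _ hp0, Nat.div_eq_of_lt hr, zero_add] at h1
    rw [hl]
    omega
  have h1 := key r hr
  have h2 := key (p - r) (by omega)
  rw [hN.2 r h0 hr, charge_sub h0 hr] at h2
  omega

/-! ### The size of a core as a quadratic form -/

theorem two_mul_sum_range_add_mul (r p k : ℕ) :
    (2 * ∑ j ∈ Finset.range k, ((r + p * j : ℕ) : ℤ)) = 2 * r * k + p * k * (k - 1) := by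
  induction k with
  | zero => simp
  | succ k ih => rw [Finset.sum_range_succ, mul_add, ih]; push_cast; ring

theorem sum_beadSet (hp : 0 < p) (N : ℕ → ℤ) :
    ∑ a ∈ beadSet p N, a = ∑ r ∈ Finset.range p, ∑ j ∈ Finset.range (N r).toNat, (r + p * j) := by
  rw [beadSet, Finset.sum_biUnion]
  · refine Finset.sum_congr rfl fun r _ => Finset.sum_image fun x _ y _ h => ?_
    exact Nat.eq_of_mul_eq_mul_left hp (Nat.add_left_cancel h)
  · intro r hr r' hr' hne
    refine Finset.disjoint_left.2 fun a h1 h2 => hne ?_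
    obtain ⟨j, -, rfl⟩ := Finset.mem_image.1 h1
    obtain ⟨j', -, h3⟩ := Finset.mem_image.1 h2
    have h4 := congrArg (· % p) h3
    simp only [Nat.add_mul_mod_self_left] at h4
    rw [Nat.mod_eq_of_lt (Finset.mem_range.1 hr), Nat.mod_eq_of_lt (Finset.mem_range.1 hr')] at h4
    exact h4.symm

theorem sum_range_odd {R : Type*} [AddCommMonoid R] (f : ℕ → R) (hpt : p = 2 * t + 1) :
    ∑ r ∈ Finset.range p, f r = f 0 + ∑ i ∈ Finset.Icc 1 t, (f i + f (p - i)) := by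
  have h2 : (∑ i ∈ Finset.Icc 1 t, f (p - i)) = ∑ i ∈ Finset.Icc (t + 1) (2 * t), f i := by
    refine Finset.sum_nbij' (fun i => p - i) (fun i => p - i) ?_ ?_ ?_ ?_ ?_ <;>
      intro i hi <;> simp only [Finset.mem_Icc] at hi ⊢ <;> omega
  have h3 : Finset.range p = insert 0 (Finset.Icc 1 t ∪ Finset.Icc (t + 1) (2 * t)) := by
    ext i
    simp only [Finset.mem_range, Finset.mem_insert, Finset.mem_union, Finset.mem_Icc]
    omega
  rw [h3, Finset.sum_insert (by simp), Finset.sum_union, Finset.sum_add_distrib, h2]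
  refine Finset.disjoint_left.2 fun i h4 h5 => ?_
  simp only [Finset.mem_Icc] at h4 h5
  omega

/-- The quadratic form computing the size of a core. -/
def coreEnergy (p t : ℕ) (n : ℕ → ℤ) : ℤ :=
  ∑ i ∈ Finset.Icc 1 t, (p * n i ^ 2 + (2 * i - p) * n i)

/-- Each nonempty runner contributes an arithmetic progression. A negative label `n` places `-n`
beads on runner `p - i`, and their doubled sum is given by the same polynomial `p n ^ 2 + (2 i - p)
n`. -/
theorem IsBarCore.two_mul_card {l : YoungDiagram} (h : IsBarCore p l) (hpt : p = 2 * t + 1) :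
    2 * (l.card : ℤ) = coreEnergy p t (charge p (parts l)) := by
  have hp0 : 0 < p := by omega
  set N := charge p (parts l)
  have h1 : parts l = (beadSet p N).val :=
    (Multiset.Nodup.ext h.nodup (beadSet p N).nodup).2 fun a => by
      rw [h.mem_iff (by omega), Finset.mem_val, mem_beadSet hp0]
  have h2 : l.card = ∑ a ∈ beadSet p N, a := by
    rw [card_eq_sum_parts, h1, Finset.sum, Multiset.map_id']
  rw [h2, sum_beadSet hp0, sum_range_odd _ hpt, coreEnergy]
  have hN : IsCharge p N := isCharge_charge _
  rw [hN.1]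
  push_cast
  simp only [Finset.range_zero, Finset.sum_empty, zero_add]
  rw [Finset.mul_sum]
  refine Finset.sum_congr rfl fun i hi => ?_
  rw [Finset.mem_Icc] at hi
  have e1 := two_mul_sum_range_add_mul i p (N i).toNat
  have e2 := two_mul_sum_range_add_mul (p - i) p (N (p - i)).toNat
  rw [hN.2 i (by omega) (by omega)] at e2 ⊢
  push_cast [show i ≤ p by omega] at e1 e2 ⊢
  rw [mul_add, e1, e2]
  rcases le_total 0 (N i) with h0 | h0
  · rw [Int.toNat_of_nonneg h0, Int.toNat_of_nonpos (by omega : -N i ≤ 0)]; push_cast; ring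
  · rw [Int.toNat_of_nonpos h0, Int.toNat_of_nonneg (by omega : 0 ≤ -N i)]; push_cast; ring

/-! ### Labels of blocks -/

namespace SpinBlock

theorem two_mul_rank (B : SpinBlock p) (hpt : p = 2 * t + 1) :
    2 * (B.rank : ℤ) = coreEnergy p t (charge p (parts B.core)) + 2 * p * B.weight := by
  rw [rank]
  push_cast
  rw [mul_add, B.isBarCore.two_mul_card hpt]
  ring

theorem exists_charge_eq (hp : p % 2 = 1) {N : ℕ → ℤ} (hN : IsCharge p N) (w : ℕ) :
    ∃ B : SpinBlock p, B.weight = w ∧ ∀ r < p, charge p (parts B.core) r = N r := by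
  obtain ⟨l, h1, h2⟩ := exists_isBarCore hp hN
  exact ⟨⟨l, h1, w⟩, rfl, h2⟩

/-- The label `n_i` of a block: the number of beads of its core on runner `i` minus the number on
runner `p - i`. -/
def label (B : SpinBlock p) (i : ℕ) : ℤ := charge p (parts B.core) i

theorem ext_label {B C : SpinBlock p} (hpt : p = 2 * t + 1) (hw : B.weight = C.weight)
    (h : ∀ i, 1 ≤ i → i ≤ t → B.label i = C.label i) : B = C :=
  SpinBlock.ext (B.isBarCore.eq_of_charge_eq C.isBarCore (by omega) fun _ hr =>
    (isCharge_charge _).ext (isCharge_charge _) hpt h hr) hw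

end SpinBlock

theorem coreEnergy_sub_of_eq_off {m n : ℕ → ℤ} {i : ℕ} (h1 : 1 ≤ i) (ht : i ≤ t)
    (h : ∀ j, 1 ≤ j → j ≤ t → j ≠ i → m j = n j) :
    coreEnergy p t m - coreEnergy p t n =
      (p * m i ^ 2 + (2 * i - p) * m i) - (p * n i ^ 2 + (2 * i - p) * n i) := by
  rw [coreEnergy, coreEnergy, ← Finset.sum_sub_distrib]
  refine Finset.sum_eq_single i (fun j hj hne => ?_) fun hi => ?_
  · rw [Finset.mem_Icc] at hj
    rw [h j hj.1 hj.2 hne, sub_self]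
  · exact absurd (Finset.mem_Icc.2 ⟨h1, ht⟩) hi

theorem coreEnergy_sub_of_eq_off_pair {m n : ℕ → ℤ} {i : ℕ} (h1 : 1 ≤ i) (ht : i + 1 ≤ t)
    (h : ∀ j, 1 ≤ j → j ≤ t → j ≠ i → j ≠ i + 1 → m j = n j) :
    coreEnergy p t m - coreEnergy p t n =
      ((p * m i ^ 2 + (2 * i - p) * m i) - (p * n i ^ 2 + (2 * i - p) * n i)) +
      ((p * m (i + 1) ^ 2 + (2 * (i + 1) - p) * m (i + 1)) -
        (p * n (i + 1) ^ 2 + (2 * (i + 1) - p) * n (i + 1))) := by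
  rw [coreEnergy, coreEnergy, ← Finset.sum_sub_distrib,
    Finset.sum_eq_add (a := i) (b := i + 1) (by omega)]
  · push_cast; rfl
  · intro j hj hne
    rw [Finset.mem_Icc] at hj
    rw [h j hj.1 hj.2 hne.1 hne.2, sub_self]
  · exact fun hi => absurd (Finset.mem_Icc.2 ⟨h1, by omega⟩) hi
  · exact fun hi => absurd (Finset.mem_Icc.2 ⟨by omega, ht⟩) hi

/-! ### Labels and ranks along the edges of the block-reduced crystal graph -/

theorem beadCharge_of_le (hpt : p = 2 * t + 1) {a j : ℕ} (ha : a ≤ t) (hj : 1 ≤ j) (hjt : j ≤ t) :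
    beadCharge p a j = if j = a then 1 else 0 := by
  rw [beadCharge, Nat.mod_eq_of_lt (by omega : a < p), Nat.mod_eq_of_lt (by omega : p - j < p)]
  split_ifs <;> omega

theorem beadCharge_add_one_self (hpt : p = 2 * t + 1) {j : ℕ} (ht : 1 ≤ t) (hjt : j ≤ t) :
    beadCharge p (t + 1) j = - beadCharge p t j := by
  have := beadCharge_add (p := p) (a := t + 1) (b := t) (r := j) (by omega)
    (by rw [hpt, show t + 1 + t = 2 * t + 1 by ring]; exact Nat.mod_self _) (by omega)
  omega

theorem mem_of_mem_foldl_pushSign {x : Bool × (ℕ × ℕ)} {kept xs : List (Bool × (ℕ × ℕ))}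
    (h : x ∈ xs.foldl pushSign kept) : x ∈ kept ∨ x ∈ xs := by
  induction xs generalizing kept with
  | nil => exact Or.inl h
  | cons y ys ih =>
    rcases ih h with h1 | h1
    · have h2 : x ∈ kept ∨ x = y := by
        unfold pushSign at h1
        split at h1
        · exact Or.inl (List.mem_cons_of_mem _ h1)
        · rcases List.mem_cons.1 h1 with h1 | h1
          · exact Or.inr h1
          · exact Or.inl h1
      rcases h2 with h2 | rfl
      · exact Or.inl h2
      · exact Or.inr List.mem_cons_self
    · exact Or.inr (List.mem_cons_of_mem _ h1)

theorem mem_signature_of_mem_reducedSignature {i : ℕ} {l : YoungDiagram} {x : Bool × (ℕ × ℕ)}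
    (h : x ∈ reducedSignature p i l) : x ∈ signature p i l := by
  rw [reducedSignature, List.mem_reverse] at h
  exact (mem_of_mem_foldl_pushSign h).resolve_left List.not_mem_nil

theorem nodeSign_eq_some {i : ℕ} {l : YoungDiagram} {A : ℕ × ℕ} {x : Bool × (ℕ × ℕ)}
    (h : nodeSign p i l A = some x) : x.2 = A ∧
      (x.1 = true → IsAddable p i l A) ∧ (x.1 = false → IsRemovable p i l A) := by
  unfold nodeSign at h
  split_ifs at h with h1 h2 <;> cases h <;> simp_all

theorem mem_signature {i : ℕ} {l : YoungDiagram} {x : Bool × (ℕ × ℕ)} :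
    x ∈ signature p i l ↔ x.2.1 < l.colLen 0 + 1 ∧ x.2.2 < l.rowLen x.2.1 + 2 ∧
      nodeSign p i l x.2 = some x := by
  simp only [signature, List.mem_flatMap, List.mem_reverse, List.mem_range, List.mem_filterMap]
  constructor
  · rintro ⟨r, hr, s, hs, h⟩
    have := (nodeSign_eq_some h).1
    rw [this]
    exact ⟨hr, hs, h⟩
  · rintro ⟨h1, h2, h3⟩
    exact ⟨x.2.1, h1, x.2.2, h2, h3⟩

theorem res_of_mem_signature {i : ℕ} {l : YoungDiagram} {x : Bool × (ℕ × ℕ)}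
    (h : x ∈ signature p i l) : res p x.2.2 = i := by
  have h1 := nodeSign_eq_some (mem_signature.1 h).2.2
  rcases hx : x.1 with _ | _
  · exact (h1.2.2 hx).1
  · exact (h1.2.1 hx).1

theorem IsGood.mem_reducedSignature {i : ℕ} {l : YoungDiagram} {A : ℕ × ℕ}
    (h : IsGood p i l A) : (false, A) ∈ reducedSignature p i l :=
  (List.mem_filter.1 (List.mem_of_getLast? h)).1

theorem IsCogood.mem_reducedSignature {i : ℕ} {l : YoungDiagram} {A : ℕ × ℕ}
    (h : IsCogood p i l A) : (true, A) ∈ reducedSignature p i l :=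
  (List.mem_filter.1 (List.mem_of_head? h)).1

theorem res_eq_iff (hp : 0 < p) {s i : ℕ} (hi : 2 * i < p) :
    res p s = i ↔ s % p = i ∨ s % p = p - 1 - i := by
  have := Nat.mod_lt s hp
  unfold res
  omega

/-- The column of a node of residue `i` is congruent to `i` or to `p - 1 - i`. In the second case
the bead moves from runner `p - 1 - i` to `p - i`, which by oddness has the same effect as a move
from `i` to `i + 1`. -/
theorem beadCharge_add_one_sub (hp : 0 < p) {s i r : ℕ} (hi : 2 * i < p)
    (h : res p s = i) (hr : r < p) :
    beadCharge p (s + 1) r - beadCharge p s r = beadCharge p (i + 1) r - beadCharge p i r := by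
  have hadd : (s + 1) % p = (s % p + 1) % p := by simp
  rcases (res_eq_iff hp hi).1 h with h1 | h1
  · rw [beadCharge_congr (a := s + 1) (b := i + 1) (by rw [hadd, h1]),
      beadCharge_congr (a := s) (b := i) (by rw [h1, Nat.mod_eq_of_lt (by omega)])]
  · have e1 := beadCharge_add (a := s + 1) (b := i) (r := r) hp
      (by rw [Nat.add_right_comm, Nat.add_mod, Nat.add_mod s i, h1, Nat.mod_eq_of_lt (by omega : i < p),
        ← Nat.add_mod_mod]; simp [show p - 1 - i + i + 1 = p by omega]) hr
    have e2 := beadCharge_add (a := s) (b := i + 1) (r := r) hp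
      (by rw [Nat.add_mod, h1, Nat.add_mod_mod, show p - 1 - i + (i + 1) = p by omega,
        Nat.mod_self]) hr
    omega

theorem AddsNode.charge {l m : YoungDiagram} {A : ℕ × ℕ} (h : AddsNode l A m) (hp : 0 < p)
    {i r : ℕ} (hi : 2 * i < p) (hA : res p A.2 = i) (hr : r < p) :
    charge p (parts m) r = charge p (parts l) r + (beadCharge p (i + 1) r - beadCharge p i r) := by
  rw [← beadCharge_add_one_sub hp hi hA hr]
  exact h.sum_map (fun a => beadCharge p a r) (beadCharge_zero hr)

theorem CrystalEdge.card {i : ℕ} {l m : YoungDiagram} (h : CrystalEdge p i l m) :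
    m.card = l.card + 1 := by
  obtain ⟨-, -, A, hA, -⟩ := h
  exact hA.card

theorem CrystalEdge.charge {i : ℕ} {l m : YoungDiagram} (h : CrystalEdge p i l m) (hp : 0 < p)
    (hi : 2 * i < p) {r : ℕ} (hr : r < p) :
    charge p (parts m) r = charge p (parts l) r + (beadCharge p (i + 1) r - beadCharge p i r) := by
  obtain ⟨-, -, A, hA, h⟩ := h
  refine hA.charge hp hi ?_ hr
  rcases h with h | h
  · exact res_of_mem_signature (mem_signature_of_mem_reducedSignature h.mem_reducedSignature)
  · exact res_of_mem_signature (mem_signature_of_mem_reducedSignature h.mem_reducedSignature)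

namespace SpinBlock

/-- The labels of `C` are those obtained from `B` by adding a node of residue `i`. -/
def IsSucc (i : ℕ) (B C : SpinBlock p) : Prop :=
  (∀ r < p, charge p (parts C.core) r =
    charge p (parts B.core) r + (beadCharge p (i + 1) r - beadCharge p i r)) ∧
  C.rank = B.rank + 1

theorem Edge.isSucc {i : ℕ} {B C : SpinBlock p} (h : Edge i B C) (hpt : p = 2 * t + 1)
    (hi : i ≤ t) : IsSucc i B C := by
  obtain ⟨l, m, hl, hm, hlm⟩ := h
  have hp : 0 < p := by omega
  refine ⟨fun r hr => ?_, ?_⟩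
  · rw [← hl.charge hp hr, ← hm.charge hp hr, hlm.charge hp (by omega) hr]
  · rw [← hl.card, ← hm.card, hlm.card]

section weights

variable {B C : SpinBlock p} {i : ℕ}

/-- The weight of `C` is left free, so that this form serves twice: for an edge the ranks are known
and the weight follows; for a candidate `C` of weight `0` the ranks follow. -/
theorem rank_eq_of_charge_zero (hpt : p = 2 * t + 1) (ht : 1 ≤ t)
    (h : ∀ r < p, charge p (parts C.core) r =
      charge p (parts B.core) r + (beadCharge p (0 + 1) r - beadCharge p 0 r)) :
    (C.rank : ℤ) = B.rank + 1 + p * (C.weight - (B.weight - B.label 1)) := by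
  have h1 := h 1 (by omega)
  rw [beadCharge_of_le hpt (by omega) le_rfl ht, beadCharge_of_le hpt (by omega) le_rfl ht] at h1
  have h2 := coreEnergy_sub_of_eq_off (p := p) (m := charge p (parts C.core))
    (n := charge p (parts B.core)) le_rfl ht fun j hj hjt hne => by
      rw [h j (by omega), beadCharge_of_le hpt (by omega) hj hjt,
        beadCharge_of_le hpt (by omega) hj hjt, if_neg (by omega), if_neg (by omega)]; ring
  have h3 := C.two_mul_rank hpt
  have h4 := B.two_mul_rank hpt
  rw [h1] at h2
  simp only [label]
  norm_num at h2
  linarith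

theorem rank_eq_of_charge_mid (hpt : p = 2 * t + 1) (h1 : 1 ≤ i) (ht : i < t)
    (h : ∀ r < p, charge p (parts C.core) r =
      charge p (parts B.core) r + (beadCharge p (i + 1) r - beadCharge p i r)) :
    (C.rank : ℤ) = B.rank + 1 +
      p * (C.weight - (B.weight - 1 + B.label i - B.label (i + 1))) := by
  have e1 := h i (by omega)
  have e2 := h (i + 1) (by omega)
  rw [beadCharge_of_le hpt (by omega) (by omega) (by omega),
    beadCharge_of_le hpt (by omega) (by omega) (by omega)] at e1 e2
  have h2 := coreEnergy_sub_of_eq_off_pair (p := p) (m := charge p (parts C.core))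
    (n := charge p (parts B.core)) h1 ht fun j hj hjt hne hne' => by
      rw [h j (by omega), beadCharge_of_le hpt (by omega) hj hjt,
        beadCharge_of_le hpt (by omega) hj hjt, if_neg (by omega), if_neg (by omega)]; ring
  have h3 := C.two_mul_rank hpt
  have h4 := B.two_mul_rank hpt
  rw [e1, e2] at h2
  simp only [label]
  norm_num at h2
  linarith

theorem rank_eq_of_charge_top (hpt : p = 2 * t + 1) (ht : 1 ≤ t)
    (h : ∀ r < p, charge p (parts C.core) r =
      charge p (parts B.core) r + (beadCharge p (t + 1) r - beadCharge p t r)) :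
    (C.rank : ℤ) = B.rank + 1 + p * (C.weight - (B.weight - 2 + 2 * B.label t)) := by
  have h1 := h t (by omega)
  rw [beadCharge_add_one_self hpt ht le_rfl,
    beadCharge_of_le hpt (by omega) (by omega) (by omega)] at h1
  have h2 := coreEnergy_sub_of_eq_off (p := p) (m := charge p (parts C.core))
    (n := charge p (parts B.core)) ht le_rfl fun j hj hjt hne => by
      rw [h j (by omega), beadCharge_add_one_self hpt ht hjt,
        beadCharge_of_le hpt (by omega) hj hjt, if_neg (by omega)]; ring
  have h3 := C.two_mul_rank hpt
  have h4 := B.two_mul_rank hpt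
  rw [h1] at h2
  simp only [label]
  have hpz : (p : ℤ) = 2 * t + 1 := by exact_mod_cast hpt
  norm_num at h2
  linarith

theorem weight_eq_of_rank_eq {x : ℤ} (hp : 0 < p) (hs : C.rank = B.rank + 1)
    (h : (C.rank : ℤ) = B.rank + 1 + p * (C.weight - x)) : (C.weight : ℤ) = x := by
  have h1 : (p : ℤ) * (C.weight - x) = 0 := by rw [hs] at h; push_cast at h; linarith
  rcases mul_eq_zero.1 h1 with h2 | h2
  · omega
  · linarith

theorem IsSucc.weight_zero (h : IsSucc 0 B C) (hpt : p = 2 * t + 1) (ht : 1 ≤ t) :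
    (C.weight : ℤ) = B.weight - B.label 1 :=
  weight_eq_of_rank_eq (by omega) h.2 (rank_eq_of_charge_zero hpt ht h.1)

theorem IsSucc.weight_mid (h : IsSucc i B C) (hpt : p = 2 * t + 1) (h1 : 1 ≤ i) (ht : i < t) :
    (C.weight : ℤ) = B.weight - 1 + B.label i - B.label (i + 1) :=
  weight_eq_of_rank_eq (by omega) h.2 (rank_eq_of_charge_mid hpt h1 ht h.1)

theorem IsSucc.weight_top (h : IsSucc t B C) (hpt : p = 2 * t + 1) (ht : 1 ≤ t) :
    (C.weight : ℤ) = B.weight - 2 + 2 * B.label t :=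
  weight_eq_of_rank_eq (by omega) h.2 (rank_eq_of_charge_top hpt ht h.1)

/-- A block above `B` along this string would have negative weight. The same reason underlies the
analogues for the other residues. -/
theorem atHighEnd_zero (hpt : p = 2 * t + 1) (ht : 1 ≤ t) (h : B.weight < B.label 1) :
    B.AtHighEnd 0 := by
  rintro ⟨C, hC⟩
  have := (hC.isSucc hpt (by omega)).weight_zero hpt ht
  omega

theorem atHighEnd_mid (hpt : p = 2 * t + 1) (h1 : 1 ≤ i) (ht : i < t)
    (h : B.label i + B.weight ≤ B.label (i + 1)) : B.AtHighEnd i := by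
  rintro ⟨C, hC⟩
  have := (hC.isSucc hpt (by omega)).weight_mid hpt h1 ht
  omega

theorem atHighEnd_top (hpt : p = 2 * t + 1) (ht : 1 ≤ t) (h : 2 * B.label t < 2 - B.weight) :
    B.AtHighEnd t := by
  rintro ⟨C, hC⟩
  have := (hC.isSucc hpt (by omega)).weight_top hpt ht
  omega

end weights

end SpinBlock

/-! ### The Scopes involutions on labels -/

namespace SpinBlock

/-- If `n_1 > 0`, the bead `1` disappears and the other `n_1 - 1` beads of runner `1` move to runner
`p - 1`; if `n_1 ≤ 0`, the `-n_1` beads of runner `p - 1` move to runner `1`, where `1` joins them.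
Both give `1 - n_1`. The core with these charges is constructed first, and its beads are then
compared with the image. -/
theorem exists_isScopesImage_zero (hpt : p = 2 * t + 1) (ht : 1 ≤ t) (B : SpinBlock p) :
    ∃ C : SpinBlock p, IsScopesImage 0 B C ∧ C.label 1 = 1 - B.label 1 ∧
      ∀ j, 2 ≤ j → j ≤ t → C.label j = B.label j := by
  have hodd : p % 2 = 1 := by omega
  have hp : 0 < p := by omega
  set N := charge p (parts B.core)
  have hN : IsCharge p N := isCharge_charge _
  set N' : ℕ → ℤ := fun r => if r = 1 then 1 - N 1 else if r = p - 1 then N 1 - 1 else N r with hN'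
  have hc : IsCharge p N' := by
    refine ⟨?_, fun r h0 hr => ?_⟩
    · simp only [hN']
      rw [if_neg (by omega), if_neg (by omega), hN.1]
    · have := hN.2 r h0 hr
      simp only [hN']
      split_ifs <;> omega
  obtain ⟨C, hCw, hC⟩ := exists_charge_eq hodd hc B.weight
  refine ⟨C, ⟨?_, hCw⟩, hC 1 (by omega), fun j hj hjt => ?_⟩
  swap
  · rw [label, hC j (by omega)]
    simp only [hN']
    rw [if_neg (by omega), if_neg (by omega)]; rfl
  set τ : ℕ → ℕ := fun a => if a % p = 1 then a - 2 else if a % p = p - 1 then a + 2 else a with hτ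
  have hBn := B.isBarCore.nodup
  -- Away from the bead `1`, treated separately, `τ` is an involution exchanging place `k + 1` of
  -- runner `1` with place `k` of runner `p - 1`.
  have key : ∀ a, a ≠ 1 → τ a ≠ 1 ∧ τ (τ a) = a ∧ ((τ a ∈ parts B.core) ↔ a ∈ parts C.core) := by
    intro a ha
    have hlt := Nat.mod_lt a hp
    have hdiv := Nat.mod_add_div a p
    have hNp := hN.2 1 (by omega) (by omega)
    rw [B.isBarCore.mem_iff hodd, C.isBarCore.mem_iff hodd, hC _ hlt]
    have hmd : ∀ r k, r < p → (r + p * k) % p = r ∧ (r + p * k) / p = k := fun r k hr => by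
      rw [Nat.add_mul_mod_self_left, Nat.mod_eq_of_lt hr, Nat.add_mul_div_left _ _ hp,
        Nat.div_eq_of_lt hr]
      simp
    change _ ∧ _ ∧ (_ < N _ ↔ _)
    by_cases h1 : a % p = 1
    · obtain ⟨k, hk⟩ : ∃ k, a / p = k + 1 := Nat.exists_eq_succ_of_ne_zero fun h0 => by
        rw [h1, h0] at hdiv; omega
      have e1 : τ a = (p - 1) + p * k := by
        simp only [hτ, if_pos h1]
        rw [h1, hk, Nat.mul_succ] at hdiv
        omega
      have e2 : τ (τ a) = a := by
        rw [e1]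
        simp only [hτ]
        rw [(hmd _ k (by omega)).1, if_neg (by omega), if_pos rfl]
        rw [h1, hk, Nat.mul_succ] at hdiv
        omega
      refine ⟨fun h => ?_, e2, ?_⟩
      · rw [e1] at h
        have := (hmd (p - 1) k (by omega)).1
        rw [h, Nat.mod_eq_of_lt (by omega)] at this
        omega
      · rw [e1, (hmd _ k (by omega)).1, (hmd _ k (by omega)).2, h1, hk, hNp]
        simp only [hN', if_true]
        push_cast
        omega
    · by_cases h2 : a % p = p - 1
      · have e1 : τ a = 1 + p * (a / p + 1) := by
          simp only [hτ, if_neg h1, if_pos h2]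
          rw [h2] at hdiv
          rw [Nat.mul_succ]
          omega
        have e2 : τ (τ a) = a := by
          rw [e1]
          simp only [hτ]
          rw [(hmd 1 _ (by omega)).1, if_pos rfl]
          rw [h2] at hdiv
          rw [Nat.mul_succ]
          omega
        refine ⟨fun h => ?_, e2, ?_⟩
        · rw [e1, Nat.mul_succ] at h
          omega
        · rw [e1, (hmd 1 _ (by omega)).1, (hmd 1 _ (by omega)).2, h2]
          simp only [hN', if_true]
          rw [if_neg (by omega)]
          push_cast
          omega
      · have e1 : τ a = a := by simp only [hτ, if_neg h1, if_neg h2]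
        rw [e1, e1]
        refine ⟨ha, rfl, ?_⟩
        simp only [hN', if_neg h1, if_neg h2]
  have h1C : 1 ∈ parts C.core ↔ 1 ∉ parts B.core := by
    rw [B.isBarCore.mem_iff hodd, C.isBarCore.mem_iff hodd, hC _ (Nat.mod_lt _ hp),
      Nat.mod_eq_of_lt (by omega), Nat.div_eq_of_lt (by omega)]
    change _ ↔ ¬ (_ < N 1)
    simp only [hN', if_true]
    push_cast
    omega
  set s' := ((parts B.core).erase 1).map τ with hs'
  have hs'n : s'.Nodup := by
    refine Multiset.Nodup.map_on (fun x hx y hy hxy => ?_) (hBn.erase 1)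
    rw [hBn.mem_erase_iff] at hx hy
    rw [← (key x hx.1).2.1, hxy, (key y hy.1).2.1]
  have hmem' : ∀ a, a ∈ s' ↔ a ≠ 1 ∧ a ∈ parts C.core := by
    intro a
    rw [hs', Multiset.mem_map]
    constructor
    · rintro ⟨b, hb, rfl⟩
      rw [hBn.mem_erase_iff] at hb
      have hk := key b hb.1
      exact ⟨hk.1, (key _ hk.1).2.2.1 (hk.2.1.symm ▸ hb.2)⟩
    · rintro ⟨h1, h2⟩
      exact ⟨τ a, hBn.mem_erase_iff.2 ⟨(key a h1).1, (key a h1).2.2.2 h2⟩, (key a h1).2.1⟩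
  have hsc : scopes p 0 (parts B.core) = if 1 ∈ parts B.core then s' else 1 ::ₘ s' := by
    rw [scopes, if_pos rfl]
  rw [hsc]
  split_ifs with h1
  · refine (Multiset.Nodup.ext C.isBarCore.nodup hs'n).2 fun a => ?_
    rw [hmem']
    exact ⟨fun h => ⟨fun h2 => h1C.1 (h2 ▸ h) h1, h⟩, And.right⟩
  · refine (Multiset.Nodup.ext C.isBarCore.nodup
      (Multiset.nodup_cons.2 ⟨fun h => ((hmem' 1).1 h).1 rfl, hs'n⟩)).2 fun a => ?_
    rw [Multiset.mem_cons, hmem']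
    by_cases ha : a = 1
    · subst ha
      exact iff_of_true (h1C.2 h1) (Or.inl rfl)
    · simp [ha]

/-- The permutation of the beads underlying `K_i` for `i > 0`. -/
def swapRunners (p i a : ℕ) : ℕ :=
  if a % p = i ∨ a % p = p - i - 1 then a + 1
  else if a % p = i + 1 ∨ a % p = p - i then a - 1
  else a

/-- The bead permutation keeps `a / p` and acts on residues by an involution commuting with `r ↦ p -
r`. Precomposing the charges with it therefore gives the charges of a core again. -/
theorem exists_isScopesImage_pos (hpt : p = 2 * t + 1) {i : ℕ} (hi : 1 ≤ i) (hit : i ≤ t)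
    (B : SpinBlock p) : ∃ C : SpinBlock p, IsScopesImage i B C ∧
      ∀ j ≤ t, C.label j = charge p (parts B.core) (swapRunners p i j) := by
  have hodd : p % 2 = 1 := by omega
  have hp : 0 < p := by omega
  set N := charge p (parts B.core)
  have hN : IsCharge p N := isCharge_charge _
  have hval : ∀ r < p, swapRunners p i r =
      if r = i ∨ r = p - i - 1 then r + 1 else if r = i + 1 ∨ r = p - i then r - 1 else r :=
    fun r hr => by rw [swapRunners, Nat.mod_eq_of_lt hr]
  have hc : IsCharge p fun r => N (swapRunners p i r) := by
    refine ⟨?_, fun r h0 hr => ?_⟩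
    · simp only [hval 0 hp]
      rw [if_neg (by omega), if_neg (by omega), hN.1]
    · simp only [hval r hr, hval (p - r) (by omega)]
      rw [← hN.2 _ (by split_ifs <;> omega) (by split_ifs <;> omega)]
      congr 1
      split_ifs <;> omega
  obtain ⟨C, hCw, hC⟩ := exists_charge_eq hodd hc B.weight
  refine ⟨C, ⟨?_, hCw⟩, fun j hjt => hC j (by omega)⟩
  have hsplit : ∀ a, swapRunners p i a = swapRunners p i (a % p) + p * (a / p) := by
    intro a
    have hdiv := Nat.mod_add_div a p
    simp only [swapRunners, Nat.mod_mod]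
    split_ifs <;> omega
  have hlt : ∀ a, swapRunners p i (a % p) < p := fun a => by
    have := Nat.mod_lt a hp
    rw [hval _ this]
    split_ifs <;> omega
  have hmd : ∀ a, swapRunners p i a % p = swapRunners p i (a % p) ∧
      swapRunners p i a / p = a / p := fun a => by
    rw [hsplit, Nat.add_mul_mod_self_left, Nat.mod_eq_of_lt (hlt a), Nat.add_mul_div_left _ _ hp,
      Nat.div_eq_of_lt (hlt a)]
    simp
  have hinv : Function.Involutive (swapRunners p i) := by
    intro a
    rw [hsplit (swapRunners p i a), (hmd a).1, (hmd a).2]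
    conv_rhs => rw [← Nat.mod_add_div a p]
    congr 1
    have := hlt a
    have hr := Nat.mod_lt a hp
    rw [hval _ this]
    rw [hval _ hr]
    split_ifs <;> omega
  have hsc : scopes p i (parts B.core) = (parts B.core).map (swapRunners p i) := by
    rw [scopes, if_neg (by omega)]
    rfl
  rw [hsc]
  refine (Multiset.Nodup.ext C.isBarCore.nodup (B.isBarCore.nodup.map hinv.injective)).2 fun a => ?_
  rw [C.isBarCore.mem_iff hodd, hC _ (Nat.mod_lt _ hp), Multiset.mem_map]
  have h1 := B.isBarCore.mem_iff hodd (swapRunners p i a)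
  rw [(hmd a).1, (hmd a).2] at h1
  change _ < N _ ↔ _
  rw [← h1]
  exact ⟨fun h => ⟨_, h, hinv a⟩, fun ⟨b, hb, hba⟩ => by rw [← hba, hinv b]; exact hb⟩

theorem IsScopesImage.unique {i : ℕ} {B C D : SpinBlock p} (hC : IsScopesImage i B C)
    (hD : IsScopesImage i B D) : C = D :=
  SpinBlock.ext (parts_injective (hC.1.trans hD.1.symm)) (hC.2.trans hD.2.symm)

theorem exists_isScopesImage_mid (hpt : p = 2 * t + 1) {i : ℕ} (hi : 1 ≤ i) (hit : i < t)
    (B : SpinBlock p) : ∃ C : SpinBlock p, IsScopesImage i B C ∧ C.label i = B.label (i + 1) ∧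
      C.label (i + 1) = B.label i ∧
      ∀ j, 1 ≤ j → j ≤ t → j ≠ i → j ≠ i + 1 → C.label j = B.label j := by
  obtain ⟨C, h1, h2⟩ := exists_isScopesImage_pos hpt hi (by omega) B
  have hm : ∀ j ≤ t, j % p = j := fun j hj => Nat.mod_eq_of_lt (by omega)
  refine ⟨C, h1, ?_, ?_, fun j hj hjt hne hne' => ?_⟩
  · rw [h2 i (by omega), swapRunners, hm _ (by omega), if_pos (Or.inl rfl)]; rfl
  · rw [h2 (i + 1) (by omega), swapRunners, hm _ (by omega), if_neg (by omega),
      if_pos (Or.inl rfl)]; rfl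
  · rw [h2 j hjt, swapRunners, hm _ hjt, if_neg (by omega), if_neg (by omega)]; rfl

theorem exists_isScopesImage_top (hpt : p = 2 * t + 1) (ht : 1 ≤ t) (B : SpinBlock p) :
    ∃ C : SpinBlock p, IsScopesImage t B C ∧ C.label t = - B.label t ∧
      ∀ j, 1 ≤ j → j < t → C.label j = B.label j := by
  obtain ⟨C, h1, h2⟩ := exists_isScopesImage_pos hpt ht le_rfl B
  have hm : ∀ j ≤ t, j % p = j := fun j hj => Nat.mod_eq_of_lt (by omega)
  refine ⟨C, h1, ?_, fun j hj hjt => ?_⟩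
  · rw [h2 t le_rfl, swapRunners, hm _ le_rfl, if_pos (Or.inl rfl),
      show t + 1 = p - t by omega, charge_sub (by omega) (by omega)]; rfl
  · rw [h2 j hjt.le, swapRunners, hm _ hjt.le, if_neg (by omega), if_neg (by omega)]; rfl

section rank

variable {B C : SpinBlock p} {i : ℕ}

theorem rank_eq_of_scopes_zero (hpt : p = 2 * t + 1) (ht : 1 ≤ t) (hw : C.weight = B.weight)
    (h1 : C.label 1 = 1 - B.label 1) (h : ∀ j, 2 ≤ j → j ≤ t → C.label j = B.label j) :
    (C.rank : ℤ) = B.rank + (1 - 2 * B.label 1) := by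
  have h2 := coreEnergy_sub_of_eq_off (p := p) (m := C.label) (n := B.label) le_rfl ht
    fun j hj hjt hne => h j (by omega) hjt
  have h3 := C.two_mul_rank hpt
  have h4 := B.two_mul_rank hpt
  rw [hw] at h3
  change _ = coreEnergy p t C.label + _ at h3
  change _ = coreEnergy p t B.label + _ at h4
  rw [h1] at h2
  norm_num at h2
  linarith

theorem rank_eq_of_scopes_mid (hpt : p = 2 * t + 1) (hi : 1 ≤ i) (hit : i < t)
    (hw : C.weight = B.weight) (h1 : C.label i = B.label (i + 1))
    (h2 : C.label (i + 1) = B.label i)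
    (h : ∀ j, 1 ≤ j → j ≤ t → j ≠ i → j ≠ i + 1 → C.label j = B.label j) :
    (C.rank : ℤ) = B.rank + (B.label i - B.label (i + 1)) := by
  have e := coreEnergy_sub_of_eq_off_pair (p := p) (m := C.label) (n := B.label) hi hit h
  have h3 := C.two_mul_rank hpt
  have h4 := B.two_mul_rank hpt
  rw [hw] at h3
  change _ = coreEnergy p t C.label + _ at h3
  change _ = coreEnergy p t B.label + _ at h4
  rw [h1, h2] at e
  linarith

theorem rank_eq_of_scopes_top (hpt : p = 2 * t + 1) (ht : 1 ≤ t) (hw : C.weight = B.weight)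
    (h1 : C.label t = - B.label t) (h : ∀ j, 1 ≤ j → j < t → C.label j = B.label j) :
    (C.rank : ℤ) = B.rank + B.label t := by
  have h2 := coreEnergy_sub_of_eq_off (p := p) (m := C.label) (n := B.label) ht le_rfl
    fun j hj hjt hne => h j hj (by omega)
  have h3 := C.two_mul_rank hpt
  have h4 := B.two_mul_rank hpt
  rw [hw] at h3
  change _ = coreEnergy p t C.label + _ at h3
  change _ = coreEnergy p t B.label + _ at h4
  have hpz : (p : ℤ) = 2 * t + 1 := by exact_mod_cast hpt
  rw [h1] at h2
  norm_num at h2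
  rw [show 2 * (t : ℤ) - p = -1 by omega] at h2
  linarith

end rank

end SpinBlock

/-! ### Two extremal problems for sums of squares -/

section extremal

variable {z : ℕ → ℤ} {b c : ℤ}

/-- The hypothesis yields Hall's condition for the sets `F k`: a set of indices with maximum `k` has
at most `k` elements, and `F k` alone has at least as many. A system of distinct representatives is
a permutation `f` with `|z (f k)| < T k`, so the squares compare term by term. -/
theorem sum_sq_lt_of_card {T : ℕ → ℤ} (ht : 1 ≤ t)
    (h : ∀ k, 1 ≤ k → k ≤ t → k ≤ ((Finset.Icc 1 t).filter fun i => |z i| < T k).card) :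
    ∑ i ∈ Finset.Icc 1 t, z i ^ 2 < ∑ k ∈ Finset.Icc 1 t, T k ^ 2 := by
  set F : Finset.Icc 1 t → Finset ℕ := fun k => (Finset.Icc 1 t).filter fun i => |z i| < T k
  obtain ⟨f, hf, hfF⟩ := (Finset.all_card_le_biUnion_card_iff_exists_injective F).1 fun s => by
    rcases s.eq_empty_or_nonempty with rfl | hs
    · simp
    set k := s.max' hs
    have hk := Finset.mem_Icc.1 k.2
    have h1 : s.card ≤ (Finset.Icc 1 (k : ℕ)).card := by
      refine Finset.card_le_card_of_injOn (fun x => (x : ℕ)) (fun x hx => ?_)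
        (fun x _ y _ hxy => Subtype.ext hxy)
      have h2 : (x : ℕ) ≤ k := s.le_max' x hx
      exact Finset.mem_coe.2 (Finset.mem_Icc.2 ⟨(Finset.mem_Icc.1 x.2).1, h2⟩)
    rw [Nat.card_Icc, Nat.add_sub_cancel] at h1
    exact (h1.trans (h k hk.1 hk.2)).trans
      (Finset.card_le_card (Finset.subset_biUnion_of_mem F (s.max'_mem hs)))
  have himg : Finset.univ.image f = Finset.Icc 1 t := by
    refine Finset.eq_of_subset_of_card_le (fun x hx => ?_) ?_
    · obtain ⟨k, -, rfl⟩ := Finset.mem_image.1 hx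
      exact (Finset.mem_filter.1 (hfF k)).1
    · rw [Finset.card_image_of_injective _ hf, Finset.card_univ, Fintype.card_coe]
  rw [← himg, Finset.sum_image (fun x _ y _ hxy => hf hxy), himg,
    ← Finset.sum_coe_sort (Finset.Icc 1 t)]
  refine Finset.sum_lt_sum_of_nonempty ⟨⟨1, Finset.mem_Icc.2 ⟨le_rfl, ht⟩⟩, Finset.mem_univ _⟩
    fun k _ => ?_
  have := (Finset.mem_filter.1 (hfF k)).2
  exact sq_lt_sq.2 (this.trans_le (le_abs_self _))

theorem le_add_mul_of_step (hs : ∀ i, 1 ≤ i → i < t → z (i + 1) ≤ z i + c) {i k : ℕ} (hi : 1 ≤ i)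
    (hk : i + k ≤ t) : z (i + k) ≤ z i + k * c := by
  induction k with
  | zero => simp
  | succ k ih =>
    have := hs (i + k) (by omega) (by omega)
    have := ih (by omega)
    push_cast
    rw [← add_assoc]
    linarith

/-- Among the sequences that start at most at `c + b`, increase by at most `c` in each step, and
end at least at `-c / 2`, the sequence `i c + b` has the largest sum of squares. -/
theorem sum_sq_lt_of_steps (hb : 0 < b) (hc : 0 < c) (ht : 1 ≤ t) (h1 : z 1 ≤ c + b)
    (hs : ∀ i, 1 ≤ i → i < t → z (i + 1) ≤ z i + c) (hlast : -c ≤ 2 * z t)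
    (hne : ∃ i, 1 ≤ i ∧ i ≤ t ∧ z i ≠ i * c + b) :
    ∑ i ∈ Finset.Icc 1 t, z i ^ 2 < ∑ i ∈ Finset.Icc 1 t, ((i : ℤ) * c + b) ^ 2 := by
  have htop : ∀ i, 1 ≤ i → i ≤ t → z i ≤ i * c + b := by
    intro i hi hit
    have := le_add_mul_of_step hs le_rfl (k := i - 1) (by omega)
    rw [Nat.add_sub_cancel' hi, Nat.cast_sub hi] at this
    push_cast at this
    linarith
  -- If no entry is negative, the upper bounds `i c + b` can be squared term by term. A negative
  -- entry needs the count of small absolute values.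
  by_cases hneg : ∃ j, 1 ≤ j ∧ j ≤ t ∧ z j < 0
  swap
  · push Not at hneg
    obtain ⟨j, hj, hjt, hjne⟩ := hne
    refine Finset.sum_lt_sum (fun i hi => ?_) ⟨j, Finset.mem_Icc.2 ⟨hj, hjt⟩, ?_⟩
    · rw [Finset.mem_Icc] at hi
      exact pow_le_pow_left₀ (hneg i hi.1 hi.2) (htop i hi.1 hi.2) 2
    · exact pow_lt_pow_left₀ (lt_of_le_of_ne (htop j hj hjt) hjne) (hneg j hj hjt) two_ne_zero
  obtain ⟨j, hj, hjt, hj0⟩ := hneg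
  refine sum_sq_lt_of_card (T := fun k => (k : ℤ) * c + b) ht fun k hk hkt => ?_
  have hkc : 0 < (k : ℤ) * c := mul_pos (by exact_mod_cast hk) hc
  have hmono : ∀ x y : ℕ, x ≤ y → (x : ℤ) * c ≤ y * c := fun x y hxy =>
    mul_le_mul_of_nonneg_right (by exact_mod_cast hxy) hc.le
  by_cases hlow : ∃ i, 1 ≤ i ∧ i ≤ t ∧ z i ≤ -(k * c + b)
  -- Take the last index at which `z` is this low. Climbing to at least `-c / 2` takes at least `k`
  -- more steps, and the next `k` entries lie strictly between `-(k c + b)` and `k c + b`.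
  · obtain ⟨i, hi, hmax⟩ : ∃ i, (1 ≤ i ∧ i ≤ t ∧ z i ≤ -(k * c + b)) ∧
        ∀ i', i < i' → i' ≤ t → -(k * c + b) < z i' := by
      set P := fun i => 1 ≤ i ∧ i ≤ t ∧ z i ≤ -(k * c + b)
      obtain ⟨i0, hi0⟩ := hlow
      classical
      refine ⟨Nat.findGreatest P t, Nat.findGreatest_spec (P := P) hi0.2.1 hi0,
        fun i' h2 h3 => ?_⟩
      by_contra h4
      exact Nat.findGreatest_is_greatest h2 h3 ⟨by omega, h3, not_lt.1 h4⟩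
    have hik : i + k ≤ t := by
      by_contra hlt
      have h2 := le_add_mul_of_step hs hi.1 (k := t - i) (by omega)
      rw [Nat.add_sub_cancel' hi.2.1] at h2
      have h3 := hmono (t - i) (k - 1) (by omega)
      rw [Nat.cast_sub hk, sub_mul] at h3
      push_cast at h3
      linarith [hi.2.2]
    have hsub : Finset.Icc (i + 1) (i + k) ⊆
        (Finset.Icc 1 t).filter fun i => |z i| < (k : ℤ) * c + b := by
      intro x hx
      rw [Finset.mem_Icc] at hx
      refine Finset.mem_filter.2 ⟨Finset.mem_Icc.2 ⟨by omega, by omega⟩, abs_lt.2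
        ⟨hmax x (by omega) (by omega), ?_⟩⟩
      have h2 := le_add_mul_of_step hs hi.1 (k := x - i) (by omega)
      rw [Nat.add_sub_cancel' (by omega)] at h2
      have h3 := hmono (x - i) k (by omega)
      linarith [hi.2.2]
    have := Finset.card_le_card hsub
    rw [Nat.card_Icc] at this
    omega
  · push Not at hlow
    have hsub : ∀ x, 1 ≤ x → x < k →
        x ∈ (Finset.Icc 1 t).filter fun i => |z i| < (k : ℤ) * c + b := by
      intro x hx hxk
      refine Finset.mem_filter.2 ⟨Finset.mem_Icc.2 ⟨hx, by omega⟩, abs_lt.2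
        ⟨hlow x hx (by omega), ?_⟩⟩
      have h2 := hmono (x + 1) k (by omega)
      push_cast at h2
      linarith [htop x hx (by omega)]
    -- The first `k - 1` indices qualify by the upper bounds, so one more is needed. If `k` itself
    -- fails, the negative index `j` serves: `j < k` would leave too few steps to reach `k c + b`.
    obtain ⟨y, hy1, hyt, hyk, hy⟩ : ∃ y, 1 ≤ y ∧ y ≤ t ∧ k ≤ y ∧ z y < k * c + b := by
      by_cases hzk : z k < k * c + b
      · exact ⟨k, hk, hkt, le_rfl, hzk⟩
      · refine ⟨j, hj, hjt, ?_, by linarith⟩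
        by_contra hjk
        have h2 := le_add_mul_of_step hs hj (k := k - j) (by omega)
        rw [Nat.add_sub_cancel' (by omega)] at h2
        have h3 := hmono (k - j) k (by omega)
        linarith
    have hins : insert y (Finset.Icc 1 (k - 1)) ⊆
        (Finset.Icc 1 t).filter fun i => |z i| < (k : ℤ) * c + b := by
      intro x hx
      rcases Finset.mem_insert.1 hx with rfl | hx
      · exact Finset.mem_filter.2 ⟨Finset.mem_Icc.2 ⟨hy1, hyt⟩, abs_lt.2 ⟨hlow x hy1 hyt, hy⟩⟩
      · rw [Finset.mem_Icc] at hx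
        exact hsub x hx.1 (by omega)
    have := Finset.card_le_card hins
    rw [Finset.card_insert_of_notMem (by rw [Finset.mem_Icc]; omega), Nat.card_Icc] at this
    omega

/-- If the absolute values of `n` integers are at least `c + b` and differ pairwise by at least
`c`, then the sum of their squares is at least that of `i c + b` for `1 ≤ i ≤ n`. -/
theorem le_sum_sq_of_gaps (hb : 0 ≤ b) (hc : 0 ≤ c) (S : Finset ℕ)
    (h1 : ∀ i ∈ S, c + b ≤ |z i|)
    (h2 : ∀ i ∈ S, ∀ j ∈ S, i ≠ j → c ≤ |(|z i| - |z j|)|) :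
    ∑ k ∈ Finset.Icc 1 S.card, ((k : ℤ) * c + b) ^ 2 ≤ ∑ i ∈ S, z i ^ 2 ∧
      (S.Nonempty → ∃ i ∈ S, S.card * c + b ≤ |z i|) := by
  induction hn : S.card generalizing S with
  | zero => simp [Finset.card_eq_zero.1 hn]
  | succ n ih =>
    have hS : S.Nonempty := Finset.card_pos.1 (by omega)
    -- Remove the largest absolute value: it exceeds by at least `c` one that is already bounded
    -- below by induction.
    obtain ⟨m, hm, hmax⟩ := S.exists_max_image (fun i => |z i|) hS
    have hcard : (S.erase m).card = n := by rw [Finset.card_erase_of_mem hm, hn]; rfl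
    obtain ⟨ih1, ih2⟩ := ih (S.erase m) (fun i hi => h1 i (Finset.mem_of_mem_erase hi))
      (fun i hi j hj => h2 i (Finset.mem_of_mem_erase hi) j (Finset.mem_of_mem_erase hj)) hcard
    have key : ((n + 1 : ℕ) : ℤ) * c + b ≤ |z m| := by
      rcases (S.erase m).eq_empty_or_nonempty with he | he
      · have : n = 0 := by rw [← hcard, he, Finset.card_empty]
        subst this
        simpa using h1 m hm
      · obtain ⟨i, hi, hi2⟩ := ih2 he
        have h3 := h2 m hm i (Finset.mem_of_mem_erase hi) (Finset.ne_of_mem_erase hi).symm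
        have h4 := hmax i (Finset.mem_of_mem_erase hi)
        rw [abs_of_nonneg (by linarith : 0 ≤ |z m| - |z i|)] at h3
        push_cast
        linarith
    refine ⟨?_, fun _ => ⟨m, hm, key⟩⟩
    rw [Finset.sum_Icc_succ_top (by omega), ← Finset.sum_erase_add _ _ hm]
    refine add_le_add ih1 ?_
    rw [← sq_abs (z m)]
    exact pow_le_pow_left₀ (by positivity) key 2

end extremal

/-! ### Good nodes -/

/-- The node `A` comes before the node `B` when the rim is read from the bottom left to the top
right. -/
def Precedes (A B : ℕ × ℕ) : Prop := B.1 < A.1 ∨ A.1 = B.1 ∧ A.2 < B.2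

theorem Precedes.irrefl (A : ℕ × ℕ) : ¬ Precedes A A := by simp [Precedes]

theorem Precedes.trans {A B C : ℕ × ℕ} (h1 : Precedes A B) (h2 : Precedes B C) :
    Precedes A C := by
  unfold Precedes at *
  omega

theorem pairwise_signature (p i : ℕ) (l : YoungDiagram) :
    (signature p i l).Pairwise fun x y => Precedes x.2 y.2 := by
  rw [signature, List.pairwise_flatMap]
  constructor
  · intro r _
    rw [List.pairwise_filterMap]
    refine List.pairwise_lt_range.imp fun {s s'} hlt x hx y hy => ?_
    rw [(nodeSign_eq_some hx).1, (nodeSign_eq_some hy).1]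
    exact Or.inr ⟨rfl, hlt⟩
  · rw [List.pairwise_reverse]
    refine List.pairwise_lt_range.imp fun {r r'} hlt x hx y hy => ?_
    obtain ⟨s, -, hs⟩ := List.mem_filterMap.1 hx
    obtain ⟨s', -, hs'⟩ := List.mem_filterMap.1 hy
    rw [(nodeSign_eq_some hs).1, (nodeSign_eq_some hs').1]
    exact Or.inl hlt

/-- If no `-` follows a `+`, nothing cancels and the fold only reverses the list. -/
theorem foldl_pushSign {xs kept : List (Bool × (ℕ × ℕ))}
    (h : xs.Pairwise fun x y => x.1 = true → y.1 = true)
    (hk : ∀ x ∈ kept, x.1 = true → ∀ y ∈ xs, y.1 = true) :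
    xs.foldl pushSign kept = xs.reverse ++ kept := by
  induction xs generalizing kept with
  | nil => simp
  | cons y ys ih =>
    rw [List.pairwise_cons] at h
    have h1 : pushSign kept y = y :: kept := by
      unfold pushSign
      split
      · have := hk _ List.mem_cons_self rfl _ List.mem_cons_self
        exact absurd this (by simp)
      · rfl
    rw [List.foldl_cons, h1, ih h.2]
    · simp
    · intro x hx hx1 z hz
      rcases List.mem_cons.1 hx with rfl | hx
      · exact h.1 z hz hx1
      · exact hk x hx hx1 z (List.mem_cons_of_mem _ hz)

theorem reducedSignature_eq {i : ℕ} {l : YoungDiagram}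
    (h : ∀ D E, IsAddable p i l D → IsRemovable p i l E → ¬ Precedes D E) :
    reducedSignature p i l = signature p i l := by
  rw [reducedSignature, foldl_pushSign]
  · simp
  · refine (pairwise_signature p i l).imp_of_mem fun {x y} hx hy hxy hx1 => ?_
    by_contra hy1
    exact h _ _ ((nodeSign_eq_some (mem_signature.1 hx).2.2).2.1 hx1)
      ((nodeSign_eq_some (mem_signature.1 hy).2.2).2.2 (by simpa using hy1)) hxy
  · simp

theorem IsRemovable.lt_rowLen {i : ℕ} {l : YoungDiagram} {A : ℕ × ℕ} (h : IsRemovable p i l A) :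
    A.2 < l.rowLen A.1 := by
  rcases h.2 with ⟨m, -, hm⟩ | ⟨-, m, n, -, -, hm, -⟩
  · have := hm.rowLen.2.1; omega
  · have := hm.rowLen.2.1; omega

theorem IsAddable.mem_range {i : ℕ} {l : YoungDiagram} {A : ℕ × ℕ} (h : IsAddable p i l A) :
    A.1 < l.colLen 0 + 1 ∧ A.2 < l.rowLen A.1 + 2 := by
  have key : ∀ s m, AddsNode l (A.1, s) m → A.1 < l.colLen 0 + 1 := fun s m hm => by
    obtain ⟨h1, h2, h3⟩ := hm.rowLen
    rcases Nat.eq_zero_or_pos A.1 with h0 | h0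
    · omega
    · have h4 := m.rowLen_anti (A.1 - 1) A.1 (by omega)
      rw [h3 (A.1 - 1) (by omega)] at h4
      have := (rowLen_pos_iff l (A.1 - 1)).1 (by omega)
      omega
  rcases h.2 with ⟨m, -, hm⟩ | ⟨h1, -, m, n, -, -, hm, -⟩
  · exact ⟨key _ m hm, by have := hm.rowLen.1; omega⟩
  · exact ⟨key _ m hm, by have := hm.rowLen.1; omega⟩

/-- The signature reads `-⋯-+⋯+`, is thus already reduced, and `A` is its last `-`. Every good node
constructed here arises in this situation. -/
theorem isGood_of_order {i : ℕ} {l : YoungDiagram} {A : ℕ × ℕ} (hA : IsRemovable p i l A)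
    (hrem : ∀ E, IsRemovable p i l E → E = A ∨ Precedes E A)
    (hadd : ∀ D, IsAddable p i l D → Precedes A D) : IsGood p i l A := by
  have hsig : reducedSignature p i l = signature p i l :=
    reducedSignature_eq fun D E hD hE hDE => Precedes.irrefl A <| (hadd D hD).trans <| by
      rcases hrem E hE with rfl | h
      · exact hDE
      · exact hDE.trans h
  have hmem : (false, A) ∈ (signature p i l).filter fun x => !x.1 := by
    refine List.mem_filter.2 ⟨mem_signature.2 ⟨?_, ?_, ?_⟩, rfl⟩
    · have := (rowLen_pos_iff l A.1).1 (by have := hA.lt_rowLen; omega)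
      exact Nat.lt_succ_of_lt this
    · exact hA.lt_rowLen.trans (by simp)
    · rw [nodeSign, if_neg fun h => Precedes.irrefl A (hadd A h), if_pos hA]
  have hpw := (pairwise_signature p i l).filter fun x => !x.1
  rw [IsGood, hsig]
  obtain ⟨L1, L2, hL⟩ := List.append_of_mem hmem
  rw [hL] at hpw ⊢
  rcases L2.eq_nil_or_concat with rfl | ⟨L3, y, rfl⟩
  · simp
  · exfalso
    have h1 : Precedes A y.2 :=
      (List.pairwise_cons.1 (List.pairwise_append.1 hpw).2.1).1 y (by simp)
    have hy : y ∈ (signature p i l).filter fun x => !x.1 := by rw [hL]; simp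
    obtain ⟨hy1, hy2⟩ := List.mem_filter.1 hy
    rcases hrem y.2 ((nodeSign_eq_some (mem_signature.1 hy1).2.2).2.2 (by simpa using hy2)) with h | h
    · exact Precedes.irrefl A (h ▸ h1)
    · exact Precedes.irrefl A (h1.trans h)

theorem isCogood_of_order {i : ℕ} {l : YoungDiagram} {A : ℕ × ℕ} (hA : IsAddable p i l A)
    (hadd : ∀ D, IsAddable p i l D → D = A ∨ Precedes A D)
    (hrem : ∀ E, IsRemovable p i l E → Precedes E A) : IsCogood p i l A := by
  have hsig : reducedSignature p i l = signature p i l :=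
    reducedSignature_eq fun D E hD hE hDE => Precedes.irrefl A <| Precedes.trans (B := E) (by
      rcases hadd D hD with rfl | h
      · exact hDE
      · exact h.trans hDE) (hrem E hE)
  have hmem : (true, A) ∈ (signature p i l).filter fun x => x.1 := by
    refine List.mem_filter.2 ⟨mem_signature.2 ⟨hA.mem_range.1, hA.mem_range.2, ?_⟩, rfl⟩
    rw [nodeSign, if_pos hA]
  have hpw := (pairwise_signature p i l).filter fun x => x.1
  rw [IsCogood, hsig]
  obtain ⟨L1, L2, hL⟩ := List.append_of_mem hmem
  rw [hL] at hpw ⊢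
  rcases L1 with _ | ⟨y, L1⟩
  · simp
  · exfalso
    have h1 : Precedes y.2 A := (List.pairwise_append.1 hpw).2.2 y (by simp) (true, A) (by simp)
    have hy : y ∈ (signature p i l).filter fun x => x.1 := by rw [hL]; simp
    obtain ⟨hy1, hy2⟩ := List.mem_filter.1 hy
    rcases hadd y.2 ((nodeSign_eq_some (mem_signature.1 hy1).2.2).2.1 hy2) with h | h
    · exact Precedes.irrefl A (h ▸ h1)
    · exact Precedes.irrefl A (h.trans h1)

/-! ### Addable and removable nodes of partitions with distinct parts -/

theorem IsPStrict.dvd_of_rowLen_eq {l : YoungDiagram} (h : IsPStrict p l) {r r' : ℕ}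
    (hne : r ≠ r') (he : l.rowLen r = l.rowLen r') : p ∣ l.rowLen r := by
  have key : ∀ r r', r < r' → l.rowLen r = l.rowLen r' → p ∣ l.rowLen r := by
    intro r r' hlt he
    have h1 := l.rowLen_anti r (r + 1) (by omega)
    have h2 := l.rowLen_anti (r + 1) r' (by omega)
    exact h r (by omega)
  rcases lt_or_gt_of_ne hne with hlt | hlt
  · exact key _ _ hlt he
  · rw [he]; exact key _ _ hlt he.symm

/-- Equal residues in consecutive columns occur only where one period `…, 1, 0` meets the next `0,
1, …`. Hence the two-step clauses for addable and removable nodes matter only for residue `0`. -/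
theorem succ_mod_of_res_eq {s i : ℕ} (hp : p % 2 = 1) (hi : 2 * i < p) (h1 : res p s = i)
    (h2 : res p (s + 1) = i) : i = 0 ∧ s % p = p - 1 ∧ (s + 1) % p = 0 := by
  rw [res_eq_iff (by omega) hi] at h1 h2
  have hlt := Nat.mod_lt s (by omega : 0 < p)
  have hadd : (s + 1) % p = (s % p + 1) % p := by simp
  rw [hadd] at h2 ⊢
  rcases Nat.lt_or_ge (s % p + 1) p with h | h
  · rw [Nat.mod_eq_of_lt h] at h2 ⊢
    omega
  · rw [show s % p + 1 = p by omega, Nat.mod_self] at h2 ⊢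
    omega

/-- A necessary condition in terms of parts, for excluding or locating removable nodes: `s` cannot
already be a part unless repetitions of it are permitted. -/
theorem IsRemovable.cases {l : YoungDiagram} {i r s : ℕ} (h : IsRemovable p i l (r, s))
    (hp : p % 2 = 1) (hi : 2 * i < p) :
    res p s = i ∧ (s ∈ parts l → p ∣ s) ∧ (l.rowLen r = s + 1 ∨
      (l.rowLen r = s + 2 ∧ i = 0 ∧ s % p = p - 1 ∧ (s + 1) % p = 0)) := by
  obtain ⟨h1, ⟨m, hm, hA⟩ | ⟨h2, m, n, hm, hn, hA, hA'⟩⟩ := h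
  · obtain ⟨e1, e2, e3⟩ := hA.rowLen
    refine ⟨h1, fun hs => ?_, Or.inl e2⟩
    obtain ⟨r', hr'⟩ := (mem_parts_iff.1 hs).2
    have hne : r ≠ r' := by rintro rfl; omega
    have := hm.dvd_of_rowLen_eq hne (by rw [e1, ← e3 r' hne.symm, hr'])
    rwa [e1] at this
  · obtain ⟨e1, e2, e3⟩ := hA.rowLen
    obtain ⟨f1, f2, f3⟩ := hA'.rowLen
    refine ⟨h1, fun hs => ?_, Or.inr ⟨e2, succ_mod_of_res_eq hp hi h1 h2⟩⟩
    obtain ⟨r', hr'⟩ := (mem_parts_iff.1 hs).2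
    have hne : r ≠ r' := by rintro rfl; simp only at *; omega
    have := hn.dvd_of_rowLen_eq hne (by rw [f1, ← f3 r' hne.symm, ← e3 r' hne.symm, hr'])
    rwa [f1] at this

theorem IsAddable.cases {l : YoungDiagram} {i r s : ℕ} (h : IsAddable p i l (r, s))
    (hp : p % 2 = 1) (hi : 2 * i < p) :
    res p s = i ∧ ((l.rowLen r = s ∧ (s + 1 ∈ parts l → p ∣ s + 1)) ∨
      (l.rowLen r = s - 1 ∧ 1 ≤ s ∧ i = 0 ∧ (s - 1) % p = p - 1)) := by
  obtain ⟨h1, ⟨m, hm, hA⟩ | ⟨h0, h2, m, n, hm, hn, hA, hA'⟩⟩ := h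
  · obtain ⟨e1, e2, e3⟩ := hA.rowLen
    refine ⟨h1, Or.inl ⟨e1, fun hs => ?_⟩⟩
    obtain ⟨r', hr'⟩ := (mem_parts_iff.1 hs).2
    have hne : r ≠ r' := by rintro rfl; omega
    have := hm.dvd_of_rowLen_eq hne (by rw [e2, e3 r' hne.symm, hr'])
    rwa [e2] at this
  · simp only at h0 h2
    obtain ⟨e1, e2, e3⟩ := hA.rowLen
    have h3 := succ_mod_of_res_eq hp hi h2 (by rw [Nat.sub_add_cancel h0]; exact h1)
    exact ⟨h1, Or.inr ⟨e1, h0, h3.1, h3.2.1⟩⟩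

theorem exists_removesNode_of_notMem {l : YoungDiagram} (hl : (parts l).Nodup) {r s : ℕ}
    (hr : l.rowLen r = s + 1) (hs : s ∉ parts l) : ∃ m, AddsNode m (r, s) l ∧ (parts m).Nodup ∧
      ∀ x, x ∈ parts m ↔ 0 < x ∧ ((x ∈ parts l ∧ x ≠ s + 1) ∨ x = s) := by
  have h1 := rowLen_lt_of_nodup hl (r := r) (r' := r + 1) (by omega) (by omega)
  obtain ⟨m, hm⟩ := exists_removesNode hr (by omega)
  have hc := fun x (hx : 0 < x) => hm.count hx
  have hl1 := Multiset.nodup_iff_count_le_one.1 hl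
  have hs0 : (parts l).count s = 0 := Multiset.count_eq_zero.2 hs
  have hs1 : 0 < (parts l).count (s + 1) :=
    Multiset.count_pos.2 (mem_parts_iff.2 ⟨by omega, r, hr⟩)
  have hpos : ∀ x, x ∈ parts m → 0 < x := fun x hx => (mem_parts_iff.1 hx).1
  have key : ∀ x, 0 < x → (((parts m).count x ≤ 1) ∧
      (0 < (parts m).count x ↔ (0 < (parts l).count x ∧ x ≠ s + 1) ∨ x = s)) := by
    intro x hx
    have h2 := hc x hx
    have h3 := hl1 x
    have h4 := hl1 (s + 1)
    by_cases e1 : x = s + 1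
    · subst e1; simp at h2; omega
    · by_cases e2 : x = s
      · subst e2; simp at h2; omega
      · simp [e1, e2] at h2; omega
  refine ⟨m, hm, Multiset.nodup_iff_count_le_one.2 fun x => ?_, fun x => ?_⟩
  · rcases Nat.eq_zero_or_pos x with rfl | hx
    · rw [Multiset.count_eq_zero.2 (zero_notMem_parts m)]; omega
    · exact (key x hx).1
  · constructor
    · intro h
      refine ⟨hpos x h, ?_⟩
      rw [← Multiset.count_pos (s := parts l)]
      exact (key x (hpos x h)).2.1 (Multiset.count_pos.2 h)
    · rintro ⟨h, h'⟩
      rw [← Multiset.count_pos (s := parts l)] at h'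
      exact Multiset.count_pos.1 ((key x h).2.2 h')

theorem exists_addsNode_of_notMem {l : YoungDiagram} (hl : (parts l).Nodup) {r s : ℕ}
    (h0 : 0 < s) (hr : l.rowLen r = s) (hs : s + 1 ∉ parts l) :
    ∃ m, AddsNode l (r, s) m ∧ (parts m).Nodup ∧
      ∀ x, x ∈ parts m ↔ (x ∈ parts l ∧ x ≠ s) ∨ x = s + 1 := by
  obtain ⟨m, hm⟩ := exists_addsNode (l := l) (r := r) fun r' h => by
    have := l.rowLen_anti r' r (by omega)
    exact rowLen_lt_of_nodup hl (by omega) (by omega)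
  rw [hr] at hm
  have hc := fun x (hx : 0 < x) => hm.count hx
  have hl1 := Multiset.nodup_iff_count_le_one.1 hl
  have hs0 : (parts l).count (s + 1) = 0 := Multiset.count_eq_zero.2 hs
  have hs1 : 0 < (parts l).count s :=
    Multiset.count_pos.2 (mem_parts_iff.2 ⟨by omega, r, hr⟩)
  have key : ∀ x, 0 < x → (((parts m).count x ≤ 1) ∧
      (0 < (parts m).count x ↔ (0 < (parts l).count x ∧ x ≠ s) ∨ x = s + 1)) := by
    intro x hx
    have h2 := hc x hx
    have h3 := hl1 x
    have h4 := hl1 s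
    by_cases e1 : x = s + 1
    · subst e1; simp at h2; omega
    · by_cases e2 : x = s
      · subst e2; simp at h2; omega
      · simp [e1, e2] at h2; omega
  refine ⟨m, hm, Multiset.nodup_iff_count_le_one.2 fun x => ?_, fun x => ?_⟩
  · rcases Nat.eq_zero_or_pos x with rfl | hx
    · rw [Multiset.count_eq_zero.2 (zero_notMem_parts m)]; omega
    · exact (key x hx).1
  · rw [← Multiset.count_pos (s := parts l), ← Multiset.count_pos]
    rcases Nat.eq_zero_or_pos x with rfl | hx
    · simp [Multiset.count_eq_zero.2 (zero_notMem_parts m),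
        Multiset.count_eq_zero.2 (zero_notMem_parts l)]
    · exact (key x hx).2

/-- Every element of `S` exceeds `0` or another element of `S` by at most `p`, and by less than `p`
if it is divisible by `p`. -/
def HasSmallGaps (p : ℕ) (S : Multiset ℕ) : Prop :=
  ∀ x ∈ S, ∃ c, (c = 0 ∨ c ∈ S) ∧ c < x ∧ x ≤ c + p ∧ (p ∣ x → x < c + p)

/-- The witness `c` need not be the next part: the next row is at least as long as any smaller part,
so the true gap can only be smaller. -/
theorem HasSmallGaps.isPRestricted {l : YoungDiagram} (h : HasSmallGaps p (parts l))
    (hl : (parts l).Nodup) (hp : 0 < p) : IsPRestricted p l := by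
  refine ⟨isPStrict_of_nodup hl, fun r => ?_⟩
  rcases Nat.eq_zero_or_pos (l.rowLen r) with h0 | h0
  · rw [h0]; omega
  · obtain ⟨c, hc, h1, h2, h3⟩ := h _ (mem_parts_iff.2 ⟨h0, r, rfl⟩)
    have h4 : c ≤ l.rowLen (r + 1) := by
      rcases hc with rfl | hc
      · exact Nat.zero_le _
      · obtain ⟨-, r', rfl⟩ := mem_parts_iff.1 hc
        refine l.rowLen_anti (r + 1) r' ?_
        by_contra hlt
        have := l.rowLen_anti r' r (by omega)
        omega
    refine ⟨by omega, fun he hd => ?_⟩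
    have := h3 hd
    omega

theorem le_of_rowLen_le {l : YoungDiagram} (hl : (parts l).Nodup) {r r' : ℕ}
    (h0 : 0 < l.rowLen r) (h : l.rowLen r' ≤ l.rowLen r) : r ≤ r' := by
  by_contra hlt
  have := rowLen_lt_of_nodup hl (r := r') (r' := r) (by omega)
    (by have := l.rowLen_anti r' r (by omega); omega)
  omega

theorem lt_of_rowLen_lt {l : YoungDiagram} {r r' : ℕ} (h : l.rowLen r' < l.rowLen r) : r < r' := by
  by_contra hlt
  have := l.rowLen_anti r' r (by omega)
  omega

/-! ### Edges below a core -/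

/-- Below a core with more beads on the runners `i + 1` and `p - i` than on `i` and `p - i - 1`,
the crystal graph has a path of two edges labelled `i`. -/
theorem exists_crystalEdges_mid {M : YoungDiagram} (hM : IsBarCore p M) (hp : p % 2 = 1) {i : ℕ}
    (hi : 1 ≤ i) (hip : 2 * i + 1 < p)
    (hgap : charge p (parts M) i + 2 ≤ charge p (parts M) (i + 1)) :
    ∃ l l', CrystalEdge p i l M ∧ CrystalEdge p i l' l := by
  have hp0 : 0 < p := by omega
  have hmem := hM.mem_iff hp
  set N := charge p (parts M)
  have hNi : N (p - i) = - N i := charge_sub (by omega) (by omega) _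
  have hNi1 : N (p - (i + 1)) = - N (i + 1) := charge_sub (by omega) (by omega) _
  have hmd : ∀ r k, r < p → (r + p * k) % p = r ∧ (r + p * k) / p = k := fun r k hr => by
    rw [Nat.add_mul_mod_self_left, Nat.mod_eq_of_lt hr, Nat.add_mul_div_left _ _ hp0,
      Nat.div_eq_of_lt hr]
    simp
  have hsucc : ∀ x, x % p + 1 < p → (x + 1) % p = x % p + 1 ∧ (x + 1) / p = x / p := by
    intro x hx
    have h1 := hmd (x % p + 1) (x / p) hx
    rwa [show x % p + 1 + p * (x / p) = x + 1 by
      have := Nat.mod_add_div x p; omega] at h1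
  have hMn := hM.nodup
  have hMpos : ∀ x ∈ parts M, 0 < x := fun x hx => (mem_parts_iff.1 hx).1
  have hdvd : ∀ x ∈ parts M, ¬ p ∣ x := fun x hx => hM.not_dvd hx
  have hsub : ∀ x ∈ parts M, p < x → x - p ∈ parts M := fun x hx h => hM.sub_mem hx h
  have hres : ∀ x, res p x = i → x % p = i ∨ x % p = p - 1 - i := fun x h =>
    (res_eq_iff hp0 (by omega)).1 h
  have hres0 : ∀ x, res p x = i → ¬ p ∣ x ∧ ¬ p ∣ x + 1 ∧ 1 ≤ x := by
    intro x h
    have h1 := hres x h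
    have h2 := hsucc x (by omega)
    refine ⟨fun h => ?_, fun h => ?_, ?_⟩
    · have := Nat.mod_eq_zero_of_dvd h; omega
    · have := Nat.mod_eq_zero_of_dvd h; omega
    · by_contra h0
      rw [show x = 0 by omega, Nat.zero_mod] at h1
      omega
  have hres1 : ∀ x, res p x = i → res p (x + 1) ≠ i := fun x h h' => by
    have := succ_mod_of_res_eq hp (by omega) h h'
    omega
  -- Runner `i + 1` has larger charge than `i`, and `p - i` larger than `p - i - 1`, so `M` has no
  -- `i`-addable node.
  have hup : ∀ x ∈ parts M, res p x = i → x + 1 ∈ parts M := by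
    intro x hx h
    have h1 := hsucc x (by have := hres x h; omega)
    rw [hmem] at hx ⊢
    rw [h1.1, h1.2]
    rcases hres x h with h2 | h2
    · rw [h2] at hx ⊢; omega
    · rw [h2, show p - 1 - i = p - (i + 1) by omega] at hx
      rw [h2, show p - 1 - i + 1 = p - i by omega]
      omega
  set D := (parts M).toFinset.filter fun a => res p (a - 1) = i ∧ a - 1 ∉ parts M with hD
  have hDmem : ∀ s, s + 1 ∈ D ↔ s + 1 ∈ parts M ∧ res p s = i ∧ s ∉ parts M := by
    intro s
    simp [hD]
  have hDpos : ∀ a ∈ D, 0 < a := fun a ha => by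
    simp only [hD, Finset.mem_filter, Multiset.mem_toFinset] at ha
    exact hMpos a ha.1
  -- `D` collects the parts whose last node is `i`-removable. It is closed upwards along runners
  -- within `M`, so a bead `p` above its largest element would contradict maximality; this keeps the
  -- lowered partitions `p`-restricted.
  have hDadd : ∀ s, s + 1 ∈ D → s + 1 + p ∈ parts M → s + 1 + p ∈ D := by
    intro s hs h
    rw [hDmem] at hs
    rw [show s + 1 + p = s + p + 1 by omega] at h ⊢
    rw [hDmem]
    refine ⟨h, ?_, fun h2 => hs.2.2 ?_⟩
    · rw [← hs.2.1]; simp [res]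
    · have := hsub _ h2 (by have := (hres0 s hs.2.1).2.2; omega)
      rwa [Nat.add_sub_cancel] at this
  -- The levels from `N i` to `N (i + 1)` supply elements on runner `i + 1`, those from `-N (i + 1)`
  -- to `-N i` on runner `p - i`. The cases on signs find two of them.
  have hDcard : 1 < D.card := by
    have hrun : ∀ k : ℕ, N i ≤ k → (k : ℤ) < N (i + 1) → i + p * k + 1 ∈ D := by
      intro k h1 h2
      rw [hDmem, hmem, hmem, show i + p * k + 1 = i + 1 + p * k by omega,
        (hmd _ k (by omega)).1, (hmd _ k (by omega)).2, (hmd _ k (by omega)).1,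
        (hmd _ k (by omega)).2]
      exact ⟨h2, (res_eq_iff hp0 (by omega)).2 (Or.inl (hmd _ k (by omega)).1), by omega⟩
    have hrun' : ∀ k : ℕ, - N (i + 1) ≤ k → (k : ℤ) < - N i → p - (i + 1) + p * k + 1 ∈ D := by
      intro k h1 h2
      rw [hDmem, hmem, hmem, show p - (i + 1) + p * k + 1 = p - i + p * k by omega,
        (hmd _ k (by omega)).1, (hmd _ k (by omega)).2, (hmd _ k (by omega)).1,
        (hmd _ k (by omega)).2, hNi, hNi1]
      refine ⟨h2, (res_eq_iff hp0 (by omega)).2 (Or.inr ?_), by omega⟩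
      rw [(hmd _ k (by omega)).1]
      omega
    rw [Finset.one_lt_card]
    rcases le_total 0 (N i) with h1 | h1
    · obtain ⟨k, hk⟩ := Int.eq_ofNat_of_zero_le h1
      refine ⟨_, hrun k (by omega) (by omega), _, hrun (k + 1) (by omega) (by push_cast; omega), ?_⟩
      rw [Nat.mul_succ]
      omega
    · rcases le_total (N (i + 1)) 0 with h2 | h2
      · obtain ⟨k, hk⟩ := Int.eq_ofNat_of_zero_le (by omega : 0 ≤ - N (i + 1))
        refine ⟨_, hrun' k (by omega) (by omega), _,
          hrun' (k + 1) (by omega) (by push_cast; omega), ?_⟩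
        rw [Nat.mul_succ]
        omega
      · by_cases h3 : N i = 0
        · refine ⟨_, hrun 0 (by omega) (by omega), _, hrun 1 (by omega) (by omega), ?_⟩
          omega
        · by_cases h4 : N (i + 1) = 0
          · refine ⟨_, hrun' 0 (by omega) (by omega), _, hrun' 1 (by omega) (by omega), ?_⟩
            omega
          · refine ⟨_, hrun 0 (by omega) (by omega), _, hrun' 0 (by omega) (by omega), ?_⟩
            omega
  -- The two largest elements of `D` are lowered, the largest first: they lie in the highest rows,
  -- where the good nodes are.
  obtain ⟨a, ha, hamax⟩ := D.exists_max_image id (Finset.card_pos.1 (by omega))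
  obtain ⟨a', ha', hamax'⟩ := (D.erase a).exists_max_image id
    (Finset.card_pos.1 (by rw [Finset.card_erase_of_mem ha]; omega))
  simp only [id] at hamax hamax'
  obtain ⟨ha'ne, ha'D⟩ := Finset.mem_erase.1 ha'
  have hlt : a' < a := lt_of_le_of_ne (hamax a' ha'D) ha'ne
  replace hamax' : ∀ x ∈ D, x ≠ a → x ≤ a' := fun x hx hne =>
    hamax' x (Finset.mem_erase.2 ⟨hne, hx⟩)
  obtain ⟨s, rfl⟩ := Nat.exists_eq_succ_of_ne_zero (hDpos a ha).ne'
  obtain ⟨s', rfl⟩ := Nat.exists_eq_succ_of_ne_zero (hDpos a' ha'D).ne'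
  simp only [Nat.succ_eq_add_one] at *
  have hs := (hDmem s).1 ha
  have hs' := (hDmem s').1 ha'D
  have hs0 := hres0 s hs.2.1
  have hs'0 := hres0 s' hs'.2.1
  have hs's : s' + 1 < s := lt_of_le_of_ne (by omega) fun h => hs.2.2 (h ▸ hs'.1)
  obtain ⟨r, hr⟩ := (mem_parts_iff.1 hs.1).2
  obtain ⟨l, hlA, hln, hl⟩ := exists_removesNode_of_notMem hMn hr hs.2.2
  have hs'l : s' + 1 ∈ parts l := (hl _).2 ⟨by omega, Or.inl ⟨hs'.1, by omega⟩⟩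
  have hs'l' : s' ∉ parts l := fun h => by
    rcases ((hl _).1 h).2 with h | h
    · exact hs'.2.2 h.1
    · omega
  obtain ⟨r', hr'⟩ := (mem_parts_iff.1 hs'l).2
  obtain ⟨l', hlA', hln', hl'⟩ := exists_removesNode_of_notMem hln hr' hs'l'
  have hrl : l.rowLen r = s := hlA.rowLen.1
  have hrr' : r < r' := lt_of_rowLen_lt (l := l) (by omega)
  have gapM : HasSmallGaps p (parts M) := by
    intro x hx
    rcases Nat.lt_or_ge p x with h | h
    · exact ⟨x - p, Or.inr (hsub x hx h), by omega, by omega, fun hd => absurd hd (hdvd x hx)⟩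
    · exact ⟨0, Or.inl rfl, hMpos x hx, by omega, fun hd => absurd hd (hdvd x hx)⟩
  have gapl : HasSmallGaps p (parts l) := by
    intro x hx
    rcases ((hl x).1 hx).2 with ⟨hx1, hx2⟩ | rfl
    · rcases Nat.lt_or_ge p x with h | h
      · refine ⟨x - p, Or.inr ((hl _).2 ⟨by omega, Or.inl ⟨hsub x hx1 h, fun he => ?_⟩⟩),
          by omega, by omega, fun hd => absurd hd (hdvd x hx1)⟩
        have := hamax _ (hDadd s ha (by rw [show s + 1 + p = x by omega]; exact hx1))
        omega
      · exact ⟨0, Or.inl rfl, hMpos x hx1, by omega, fun hd => absurd hd (hdvd x hx1)⟩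
    · rcases Nat.lt_or_ge p (x + 1) with h | h
      · have := hsub _ hs.1 h
        have h0 := hMpos _ this
        exact ⟨x + 1 - p, Or.inr ((hl _).2 ⟨by omega, Or.inl ⟨this, by omega⟩⟩), by omega, by omega,
          fun hd => absurd hd hs0.1⟩
      · exact ⟨0, Or.inl rfl, by omega, by omega, fun hd => absurd hd hs0.1⟩
  have gapl' : HasSmallGaps p (parts l') := by
    intro x hx
    rcases ((hl' x).1 hx).2 with ⟨hxl, hx1⟩ | rfl
    · rcases ((hl x).1 hxl).2 with ⟨hxM, hx2⟩ | rfl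
      · rcases Nat.lt_or_ge p x with h | h
        · refine ⟨x - p, Or.inr ((hl' _).2 ⟨by omega, Or.inl ⟨(hl _).2 ⟨by omega,
            Or.inl ⟨hsub x hxM h, fun he => ?_⟩⟩, fun he => ?_⟩⟩), by omega, by omega,
            fun hd => absurd hd (hdvd x hxM)⟩
          · have := hamax _ (hDadd s ha (by rw [show s + 1 + p = x by omega]; exact hxM))
            omega
          · have h1 := hDadd s' ha'D (by rw [show s' + 1 + p = x by omega]; exact hxM)
            have := hamax' _ h1 (by omega)
            omega
        · exact ⟨0, Or.inl rfl, hMpos x hxM, by omega, fun hd => absurd hd (hdvd x hxM)⟩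
      · rcases Nat.lt_or_ge p (x + 1) with h | h
        · have h1 := hsub _ hs.1 h
          have h0 := hMpos _ h1
          -- The part below the lowered one may have been lowered as well; then `s'` is exactly `p`
          -- below `x`.
          by_cases he : x + 1 - p = s' + 1
          · exact ⟨s', Or.inr ((hl' _).2 ⟨by omega, Or.inr rfl⟩), by omega, by omega,
              fun hd => absurd hd hs0.1⟩
          · exact ⟨x + 1 - p, Or.inr ((hl' _).2 ⟨by omega, Or.inl ⟨(hl _).2 ⟨by omega,
              Or.inl ⟨h1, by omega⟩⟩, he⟩⟩), by omega, by omega, fun hd => absurd hd hs0.1⟩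
        · exact ⟨0, Or.inl rfl, by omega, by omega, fun hd => absurd hd hs0.1⟩
    · rcases Nat.lt_or_ge p (x + 1) with h | h
      · have h1 := hsub _ hs'.1 h
        have h0 := hMpos _ h1
        exact ⟨x + 1 - p, Or.inr ((hl' _).2 ⟨by omega, Or.inl ⟨(hl _).2 ⟨by omega,
          Or.inl ⟨h1, by omega⟩⟩, by omega⟩⟩), by omega, by omega, fun hd => absurd hd hs'0.1⟩
      · exact ⟨0, Or.inl rfl, by omega, by omega, fun hd => absurd hd hs'0.1⟩
  refine ⟨l, l', ⟨gapl.isPRestricted hln hp0, gapM.isPRestricted hMn hp0, (r, s), hlA, Or.inr ?_⟩,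
    gapl'.isPRestricted hln' hp0, gapl.isPRestricted hln hp0, (r', s'), hlA', Or.inr ?_⟩
  · refine isGood_of_order ⟨hs.2.1, Or.inl ⟨l, isPStrict_of_nodup hln, hlA⟩⟩ ?_ ?_
    · rintro ⟨r1, s1⟩ hE
      obtain ⟨e1, e2, e3 | e3⟩ := hE.cases hp (by omega)
      · have h1 : s1 + 1 ∈ D :=
          (hDmem s1).2 ⟨mem_parts_iff.2 ⟨by omega, r1, e3⟩, e1, fun h => (hres0 s1 e1).1 (e2 h)⟩
        have h2 := hamax _ h1
        have h3 := le_of_rowLen_le hMn (r := r) (r' := r1) (by omega) (by omega)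
        rcases h3.eq_or_lt with rfl | h3
        · left; rw [show s1 = s by omega]
        · exact Or.inr (Or.inl h3)
      · omega
    · rintro ⟨r1, s1⟩ hE
      exfalso
      obtain ⟨e1, ⟨e2, e3⟩ | e2⟩ := hE.cases hp (by omega)
      · have h1 : s1 ∈ parts M := mem_parts_iff.2 ⟨(hres0 s1 e1).2.2, r1, e2⟩
        exact (hres0 s1 e1).2.1 (e3 (hup _ h1 e1))
      · omega
  · refine isGood_of_order ⟨hs'.2.1, Or.inl ⟨l', isPStrict_of_nodup hln', hlA'⟩⟩ ?_ ?_
    · rintro ⟨r1, s1⟩ hE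
      obtain ⟨e1, e2, e3 | e3⟩ := hE.cases hp (by omega)
      · have h1 : s1 ∉ parts l := fun h => (hres0 s1 e1).1 (e2 h)
        have h2 : s1 + 1 ∈ parts l := mem_parts_iff.2 ⟨by omega, r1, e3⟩
        have h3 : s1 + 1 ≤ s' + 1 := by
          rcases ((hl _).1 h2).2 with h3 | h3
          · refine hamax' _ ((hDmem s1).2 ⟨h3.1, e1, fun h4 => h1 ((hl _).2
              ⟨(hres0 s1 e1).2.2, Or.inl ⟨h4, fun h5 => ?_⟩⟩)⟩) h3.2
            exact hres1 s hs.2.1 (h5 ▸ e1)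
          · exact absurd (h3 ▸ hs.2.1) (hres1 s1 e1)
        have h4 := le_of_rowLen_le hln (r := r') (r' := r1) (by omega) (by omega)
        rcases h4.eq_or_lt with rfl | h4
        · left; rw [show s1 = s' by omega]
        · exact Or.inr (Or.inl h4)
      · omega
    · rintro ⟨r1, s1⟩ hE
      obtain ⟨e1, ⟨e2, e3⟩ | e2⟩ := hE.cases hp (by omega)
      · have h1 : s1 ∈ parts l := mem_parts_iff.2 ⟨(hres0 s1 e1).2.2, r1, e2⟩
        have h2 : s1 + 1 ∉ parts l := fun h => (hres0 s1 e1).2.1 (e3 h)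
        -- The only `i`-addable node of `l` is the one just removed, which lies in a higher row.
        have h3 : s1 = s := by
          rcases ((hl _).1 h1).2 with h3 | h3
          · by_contra hne
            exact h2 ((hl _).2 ⟨by omega, Or.inl ⟨hup _ h3.1 e1, by omega⟩⟩)
          · exact h3
        exact Or.inl (lt_of_rowLen_lt (l := l) (by omega) : r1 < r')
      · omega

/-- Below a core with `k + 1 ≥ 2` beads on runner `1`, the crystal graph has a path of two edges
labelled `0`; it begins by replacing the part `k p + 1` with `k p`. -/
theorem exists_crystalEdges_zero {M : YoungDiagram} (hM : IsBarCore p M) (hp : p % 2 = 1)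
    (hp3 : 3 ≤ p) {k : ℕ} (hk : 1 ≤ k) (hN : charge p (parts M) 1 = k + 1) :
    ∃ l l', CrystalEdge p 0 l M ∧ CrystalEdge p 0 l' l ∧ (parts l).Nodup ∧
      HasSmallGaps p (parts l) ∧
      ∀ x, x ∈ parts l ↔ 0 < x ∧ ((x ∈ parts M ∧ x ≠ p * k + 1) ∨ x = p * k) := by
  have hp0 : 0 < p := by omega
  have hmem := hM.mem_iff hp
  have hNp : charge p (parts M) (p - 1) = - charge p (parts M) 1 :=
    charge_sub (by omega) (by omega) _
  have hmd : ∀ r k, r < p → (r + p * k) % p = r ∧ (r + p * k) / p = k := fun r k hr => by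
    rw [Nat.add_mul_mod_self_left, Nat.mod_eq_of_lt hr, Nat.add_mul_div_left _ _ hp0,
      Nat.div_eq_of_lt hr]
    simp
  have hMn := hM.nodup
  have hMpos : ∀ x ∈ parts M, 0 < x := fun x hx => (mem_parts_iff.1 hx).1
  have hdvd : ∀ x ∈ parts M, ¬ p ∣ x := fun x hx => hM.not_dvd hx
  have hdvd' : ∀ x ∈ parts M, x % p ≠ 0 := fun x hx h => hdvd x hx (Nat.dvd_of_mod_eq_zero h)
  have hsub : ∀ x ∈ parts M, p < x → x - p ∈ parts M := fun x hx h => hM.sub_mem hx h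
  have hone : ∀ j, p * j + 1 ∈ parts M ↔ j ≤ k := by
    intro j
    rw [hmem, show p * j + 1 = 1 + p * j by omega, (hmd 1 j (by omega)).1,
      (hmd 1 j (by omega)).2, hN]
    omega
  have hone' : ∀ x ∈ parts M, x % p = 1 → x ≤ p * k + 1 := by
    intro x hx h
    have hd := Nat.mod_add_div x p
    have h1 : x / p ≤ k := by
      rw [← hone, show p * (x / p) + 1 = x by omega]; exact hx
    have := Nat.mul_le_mul_left p h1
    omega
  -- Runner `p - 1` is empty since its charge is negative, so no part can be extended by a `0`-node.
  have hlast : ∀ x ∈ parts M, x % p ≠ p - 1 := by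
    intro x hx h
    rw [hmem, h, hNp, hN] at hx
    exact absurd hx (not_lt.2 ((by omega : -((k : ℤ) + 1) ≤ 0).trans (Int.natCast_nonneg _)))
  have hpk : p ≤ p * k := Nat.le_mul_of_pos_right p hk
  have hpk0 : p * k % p = 0 := Nat.mul_mod_right p k
  have hpk1 : (p * k - 1) % p = p - 1 := by
    obtain ⟨j, rfl⟩ := Nat.exists_eq_add_of_le hk
    rw [show p * (1 + j) - 1 = p - 1 + p * j by rw [mul_add]; omega]
    exact (hmd _ j (by omega)).1
  have hres : ∀ x, res p x = 0 ↔ x % p = 0 ∨ x % p = p - 1 := fun x => by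
    rw [res_eq_iff hp0 (by omega)]; simp
  have hsucc0 : ∀ x, x % p = 0 → (x + 1) % p = 1 := fun x h => by
    rw [Nat.add_mod, h, zero_add, Nat.mod_mod, Nat.mod_eq_of_lt (by omega)]
  have hsucc1 : ∀ x, x % p = p - 1 → (x + 1) % p = 0 := fun x h => by
    rw [Nat.add_mod, h, Nat.mod_eq_of_lt (by omega : 1 < p), show p - 1 + 1 = p by omega,
      Nat.mod_self]
  have hkM : p * k ∉ parts M := fun h => hdvd' _ h hpk0
  obtain ⟨r, hr⟩ := (mem_parts_iff.1 ((hone k).2 le_rfl)).2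
  obtain ⟨l, hlA, hln, hl⟩ := exists_removesNode_of_notMem hMn hr hkM
  have hrl : l.rowLen r = p * k := hlA.rowLen.1
  have hlast' : p * k - 1 ∉ parts l := fun h => by
    rcases ((hl _).1 h).2 with h | h
    · exact hlast _ h.1 hpk1
    · omega
  obtain ⟨l', hlA', hln', hl'⟩ := exists_removesNode_of_notMem hln (r := r) (s := p * k - 1)
    (by omega) hlast'
  rw [Nat.sub_add_cancel (by omega)] at hl'
  have gapM : HasSmallGaps p (parts M) := by
    intro x hx
    rcases Nat.lt_or_ge p x with h | h
    · exact ⟨x - p, Or.inr (hsub x hx h), by omega, by omega, fun hd => absurd hd (hdvd x hx)⟩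
    · exact ⟨0, Or.inl rfl, hMpos x hx, by omega, fun hd => absurd hd (hdvd x hx)⟩
  have hcM : p * (k - 1) + 1 ∈ parts M := (hone _).2 (by omega)
  have hck : p * (k - 1) + p = p * k := by
    rw [← Nat.mul_succ, Nat.succ_eq_add_one, Nat.sub_add_cancel hk]
  have hMsub : ∀ x ∈ parts M, p < x → x - p ≠ p * k + 1 := fun x hx h he => by
    have : p * (k + 1) + 1 ∈ parts M := by
      rw [Nat.mul_succ, show p * k + p + 1 = x by omega]; exact hx
    rw [hone] at this
    omega
  have gapl : HasSmallGaps p (parts l) := by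
    intro x hx
    rcases ((hl x).1 hx).2 with ⟨hx1, hx2⟩ | rfl
    · rcases Nat.lt_or_ge p x with h | h
      · exact ⟨x - p, Or.inr ((hl _).2 ⟨by omega, Or.inl ⟨hsub x hx1 h, hMsub x hx1 h⟩⟩),
          by omega, by omega, fun hd => absurd hd (hdvd x hx1)⟩
      · exact ⟨0, Or.inl rfl, hMpos x hx1, by omega, fun hd => absurd hd (hdvd x hx1)⟩
    -- The part `p * k` is divisible by `p` and needs a gap less than `p`; the bead `p * (k - 1) +
    -- 1` gives the gap `p - 1`.
    · exact ⟨p * (k - 1) + 1, Or.inr ((hl _).2 ⟨by omega, Or.inl ⟨hcM, by omega⟩⟩), by omega,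
        by omega, fun _ => by omega⟩
  have gapl' : HasSmallGaps p (parts l') := by
    intro x hx
    rcases ((hl' x).1 hx).2 with ⟨hxl, hx1⟩ | rfl
    · have hxM := (((hl x).1 hxl).2.resolve_right hx1)
      rcases Nat.lt_or_ge p x with h | h
      · refine ⟨x - p, Or.inr ((hl' _).2 ⟨by omega, Or.inl ⟨(hl _).2 ⟨by omega, Or.inl
          ⟨hsub x hxM.1 h, hMsub x hxM.1 h⟩⟩, fun he => hkM ?_⟩⟩),
          by omega, by omega, fun hd => absurd hd (hdvd x hxM.1)⟩
        rw [← he]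
        exact hsub x hxM.1 h
      · exact ⟨0, Or.inl rfl, hMpos x hxM.1, by omega, fun hd => absurd hd (hdvd x hxM.1)⟩
    · exact ⟨p * (k - 1) + 1, Or.inr ((hl' _).2 ⟨by omega, Or.inl ⟨(hl _).2 ⟨by omega,
        Or.inl ⟨hcM, by omega⟩⟩, fun he => hkM (he ▸ hcM)⟩⟩), by omega, by omega,
        fun _ => by omega⟩
  refine ⟨l, l', ⟨gapl.isPRestricted hln hp0, gapM.isPRestricted hMn hp0, (r, p * k), hlA,
    Or.inr ?_⟩, ⟨gapl'.isPRestricted hln' hp0, gapl.isPRestricted hln hp0, (r, p * k - 1), hlA',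
    Or.inr ?_⟩, hln, gapl, hl⟩
  · refine isGood_of_order ⟨(hres _).2 (Or.inl hpk0), Or.inl ⟨l, isPStrict_of_nodup hln, hlA⟩⟩ ?_ ?_
    · rintro ⟨r1, s1⟩ hE
      obtain ⟨e1, e2, e3⟩ := hE.cases hp (by omega)
      have h2 : M.rowLen r1 ∈ parts M := mem_parts_iff.2 ⟨by omega, r1, rfl⟩
      have h3 : M.rowLen r1 % p = 1 := by
        rcases e3 with e3 | ⟨e3, -, -, e4⟩
        · rw [e3]
          rcases (hres s1).1 e1 with h | h
          · exact hsucc0 _ h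
          · exact absurd (e3 ▸ h2) fun h4 => hdvd' _ h4 (hsucc1 _ h)
        · rw [e3]; exact hsucc0 _ e4
      have h4 := hone' _ h2 h3
      rcases (le_of_rowLen_le hMn (r := r) (r' := r1) (by omega) (by omega)).eq_or_lt with rfl | h5
      · rcases e3 with e3 | e3
        · left; rw [show s1 = p * k by omega]
        · exact Or.inr (Or.inr ⟨rfl, by simp only; omega⟩)
      · exact Or.inr (Or.inl h5)
    · rintro ⟨r1, s1⟩ hE
      exfalso
      obtain ⟨e1, ⟨e2, e3⟩ | ⟨e2, e3, -, e4⟩⟩ := hE.cases hp (by omega)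
      · rcases Nat.eq_zero_or_pos s1 with rfl | h0
        · have := e3 (by have := (hone 0).2 (by omega); simpa using this)
          have := Nat.le_of_dvd (by omega) this
          omega
        · have h1 : s1 ∈ parts M := mem_parts_iff.2 ⟨h0, r1, e2⟩
          rcases (hres s1).1 e1 with h | h
          · exact hdvd' _ h1 h
          · exact hlast _ h1 h
      · rcases Nat.eq_zero_or_pos (s1 - 1) with h0 | h0
        · rw [h0, Nat.zero_mod] at e4; omega
        · exact hlast _ (mem_parts_iff.2 ⟨h0, r1, e2⟩) e4
  · have hmeml : ∀ x ∈ parts l, x % p = 0 ∨ x % p = 1 → x ≤ p * k := by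
      intro x hx h
      rcases ((hl x).1 hx).2 with ⟨h1, h2⟩ | h1
      · have := hone' x h1 (h.resolve_left (hdvd' x h1)); omega
      · omega
    refine isGood_of_order ⟨(hres _).2 (Or.inr hpk1),
      Or.inl ⟨l', isPStrict_of_nodup hln', hlA'⟩⟩ ?_ ?_
    · rintro ⟨r1, s1⟩ hE
      obtain ⟨e1, e2, e3⟩ := hE.cases hp (by omega)
      have h2 : l.rowLen r1 ∈ parts l := mem_parts_iff.2 ⟨by omega, r1, rfl⟩
      have h3 : l.rowLen r1 % p = 0 ∨ l.rowLen r1 % p = 1 := by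
        rcases e3 with e3 | ⟨e3, -, -, e4⟩
        · rw [e3]
          rcases (hres s1).1 e1 with h | h
          · exact Or.inr (hsucc0 _ h)
          · exact Or.inl (hsucc1 _ h)
        · rw [e3]; exact Or.inr (hsucc0 _ e4)
      have h4 := hmeml _ h2 h3
      rcases (le_of_rowLen_le hln (r := r) (r' := r1) (by omega) (by omega)).eq_or_lt with rfl | h5
      · rcases e3 with e3 | ⟨e3, -, -, e4⟩
        · left; rw [show s1 = p * k - 1 by omega]
        · have := hsucc0 _ e4
          rw [show s1 + 1 + 1 = p * k by omega] at this
          omega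
      · exact Or.inr (Or.inl h5)
    · rintro ⟨r1, s1⟩ hE
      obtain ⟨e1, ⟨e2, e3⟩ | ⟨e2, e3, -, e4⟩⟩ := hE.cases hp (by omega)
      · rcases Nat.eq_zero_or_pos s1 with rfl | h0
        · have h1 := (hone 0).2 (by omega)
          have := e3 ((hl _).2 ⟨by omega, Or.inl ⟨by simpa using h1, by omega⟩⟩)
          have := Nat.le_of_dvd (by omega) this
          omega
        · have h1 : s1 ∈ parts l := mem_parts_iff.2 ⟨h0, r1, e2⟩
          rcases ((hl _).1 h1).2 with ⟨h2, -⟩ | h2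
          · exfalso
            rcases (hres s1).1 e1 with h | h
            · exact hdvd' _ h2 h
            · exact hlast _ h2 h
          -- The only addable `0`-node of `l` is the one just removed; it lies in the same row,
          -- immediately to the right of the next node to be removed.
          · have : r1 = r := rowLen_injective_of_nodup hln (by omega) (by omega)
            exact Or.inr ⟨this.symm, by simp only; omega⟩
      · exfalso
        rcases Nat.eq_zero_or_pos (s1 - 1) with h0 | h0
        · rw [h0, Nat.zero_mod] at e4; omega
        · rcases ((hl _).1 (mem_parts_iff.2 ⟨h0, r1, e2⟩)).2 with ⟨h2, -⟩ | h2
          · exact hlast _ h2 e4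
          · rw [h2] at e4; omega

/-- In a partition with distinct parts, among them `t` but none congruent to `t + 1`, the part `t`
can be replaced with `t + 1` along an edge labelled `t`. -/
theorem exists_crystalEdge_top {t : ℕ} (hpt : p = 2 * t + 1) (ht : 1 ≤ t) {l : YoungDiagram}
    (hln : (parts l).Nodup) (hgap : HasSmallGaps p (parts l)) (hmem : t ∈ parts l)
    (hno : ∀ x ∈ parts l, x % p ≠ t + 1) : ∃ m, CrystalEdge p t l m := by
  have hodd : p % 2 = 1 := by omega
  have hp0 : 0 < p := by omega
  obtain ⟨r, hr⟩ := (mem_parts_iff.1 hmem).2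
  obtain ⟨m, hA, hmn, hm⟩ := exists_addsNode_of_notMem hln (by omega) hr fun h =>
    hno _ h (Nat.mod_eq_of_lt (by omega))
  have hres : ∀ x, res p x = t → x % p = t := fun x h => by
    have := (res_eq_iff hp0 (by omega)).1 h
    omega
  have hrest : res p t = t := (res_eq_iff hp0 (by omega)).2 (Or.inl (Nat.mod_eq_of_lt (by omega)))
  have gapm : HasSmallGaps p (parts m) := by
    intro x hx
    rcases (hm x).1 hx with ⟨hxl, hxt⟩ | rfl
    · obtain ⟨c, hc, h1, h2, h3⟩ := hgap x hxl
      -- A gap measured from `t` is now measured from `t + 1`; this stays below `x`, because `l` has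
      -- no part congruent to `t + 1`.
      by_cases hct : c = t
      · have : x ≠ t + 1 := fun h => hno x hxl (by rw [h]; exact Nat.mod_eq_of_lt (by omega))
        exact ⟨t + 1, Or.inr ((hm _).2 (Or.inr rfl)), by omega, by omega,
          fun hd => by have := h3 hd; omega⟩
      · refine ⟨c, ?_, h1, h2, h3⟩
        rcases hc with hc | hc
        · exact Or.inl hc
        · exact Or.inr ((hm _).2 (Or.inl ⟨hc, hct⟩))
    · exact ⟨0, Or.inl rfl, by omega, by omega, fun _ => by omega⟩
  refine ⟨m, hgap.isPRestricted hln hp0, gapm.isPRestricted hmn hp0, (r, t), hA, Or.inl ?_⟩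
  refine isCogood_of_order ⟨hrest, Or.inl ⟨m, isPStrict_of_nodup hmn, hA⟩⟩ ?_ ?_
  · rintro ⟨r1, s1⟩ hE
    obtain ⟨e1, ⟨e2, e3⟩ | e2⟩ := hE.cases hodd (by omega)
    -- Addable `t`-nodes sit at parts congruent to `t`, of which `t` is the smallest and hence the
    -- lowest row.
    · have h1 := hres s1 e1
      have h2 := Nat.mod_le s1 p
      have h3 := le_of_rowLen_le hln (r := r1) (r' := r) (by omega) (by omega)
      rcases h3.eq_or_lt with rfl | h3
      · left; rw [show s1 = t by omega]
      · exact Or.inr (Or.inl h3)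
    · omega
  · rintro ⟨r1, s1⟩ hE
    exfalso
    obtain ⟨e1, e2, e3 | e3⟩ := hE.cases hodd (by omega)
    · refine hno (s1 + 1) (mem_parts_iff.2 ⟨by omega, r1, e3⟩) ?_
      rw [Nat.add_mod, hres s1 e1, Nat.mod_eq_of_lt (by omega : 1 < p)]
      exact Nat.mod_eq_of_lt (by omega)
    · omega

namespace SpinBlock

/-! ### Blocks that are not external -/

/-- Weight `0` is imposed on the candidate above `B`; the rank formula then decides whether it is
really one rank higher. -/
theorem exists_charge_succ (hpt : p = 2 * t + 1) (i : ℕ) (B : SpinBlock p) :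
    ∃ C : SpinBlock p, C.weight = 0 ∧ ∀ r < p, charge p (parts C.core) r =
      charge p (parts B.core) r + (beadCharge p (i + 1) r - beadCharge p i r) :=
  exists_charge_eq (by omega) (N := fun r => charge p (parts B.core) r +
    (beadCharge p (i + 1) r + - beadCharge p i r))
    ((isCharge_charge _).add ((isCharge_beadCharge _).add (isCharge_beadCharge _).neg)) 0

theorem contains_of_crystalEdge_core {i : ℕ} {B C : SpinBlock p} (hpt : p = 2 * t + 1)
    (hi : i ≤ t) (hs : IsSucc i B C) (hC : C.weight = 0) {l : YoungDiagram}
    (h : CrystalEdge p i l C.core) : B.Contains l := by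
  refine contains_of_charge (by omega) h.1.1 ?_ fun r hr => ?_
  · have h1 := h.card
    have h2 := hs.2
    rw [rank, hC] at h2
    omega
  · have h1 := h.charge (by omega) (by omega) hr
    have h2 := hs.1 r hr
    linarith

/-- The middle partition `l` lies in `B`, by its size and charges, and has an edge in each
direction. -/
theorem not_isExternal_of_crystalEdges {i : ℕ} {B C : SpinBlock p} (hpt : p = 2 * t + 1)
    (hi : i ≤ t) (hs : IsSucc i B C) (hC : C.weight = 0) {l l' : YoungDiagram}
    (h : CrystalEdge p i l C.core) (h' : CrystalEdge p i l' l) : ¬ IsExternal i B := by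
  have hl := contains_of_crystalEdge_core hpt hi hs hC h
  have hcore : C.Contains C.core := ⟨C.isBarCore.1, by rw [hC]; exact RemovesBars.refl _⟩
  obtain ⟨D, hD⟩ := exists_contains (by omega : 0 < p) h'.1.1
  rintro (hB | hB)
  · exact hB ⟨C, l, C.core, hl, hcore, h⟩
  · exact hB ⟨D, l', l, hD, hl, h'⟩

/-- In this borderline case the block above has weight `0`. Its labels `i` and `i + 1` differ by
`B.weight + 1 ≥ 2`, which allows two successive edges down from its core. -/
theorem not_isExternal_mid {i : ℕ} {B : SpinBlock p} (hpt : p = 2 * t + 1) (hi : 1 ≤ i)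
    (hit : i < t) (hw : 1 ≤ B.weight) (h : B.label (i + 1) = B.label i + B.weight - 1) :
    ¬ IsExternal i B := by
  obtain ⟨C, hCw, hC⟩ := exists_charge_succ hpt i B
  have hrank := rank_eq_of_charge_mid hpt hi hit hC
  rw [h, hCw, show ((0 : ℕ) : ℤ) - (B.weight - 1 + B.label i - (B.label i + B.weight - 1)) = 0 by
    push_cast; ring] at hrank
  have e1 := hC i (by omega)
  have e2 := hC (i + 1) (by omega)
  rw [beadCharge_of_le hpt (by omega) (by omega) (by omega),
    beadCharge_of_le hpt (by omega) (by omega) (by omega)] at e1 e2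
  simp only [label] at h
  simp at e1 e2
  obtain ⟨l, l', h1, h2⟩ := exists_crystalEdges_mid C.isBarCore (by omega) hi (by omega)
    (by omega)
  exact not_isExternal_of_crystalEdges hpt hit.le ⟨hC, by omega⟩ hCw h1 h2

theorem exists_succ_core_zero {B : SpinBlock p} (hpt : p = 2 * t + 1) (ht : 1 ≤ t)
    (h : B.label 1 = B.weight) : ∃ C, IsSucc 0 B C ∧ C.weight = 0 ∧
      C.label 1 = B.weight + 1 ∧ ∀ j, 2 ≤ j → j ≤ t → C.label j = B.label j := by
  obtain ⟨C, hCw, hC⟩ := exists_charge_succ hpt 0 B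
  have hrank := rank_eq_of_charge_zero hpt ht hC
  rw [h, hCw, show ((0 : ℕ) : ℤ) - (B.weight - B.weight) = 0 by push_cast; ring] at hrank
  refine ⟨C, ⟨hC, by omega⟩, hCw, ?_, fun j hj hjt => ?_⟩
  · rw [label, hC 1 (by omega), beadCharge_of_le hpt (by omega) (by omega) (by omega),
      beadCharge_of_le hpt (by omega) (by omega) (by omega), if_pos rfl, if_neg (by omega), ← h,
      label]
    ring
  · rw [label, hC j (by omega), beadCharge_of_le hpt (by omega) (by omega) (by omega),
      beadCharge_of_le hpt (by omega) (by omega) (by omega), if_neg (by omega), if_neg (by omega),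
      label]
    ring

theorem not_isExternal_zero {B : SpinBlock p} (hpt : p = 2 * t + 1) (ht : 1 ≤ t)
    (hw : 1 ≤ B.weight) (h : B.label 1 = B.weight) : ¬ IsExternal 0 B := by
  obtain ⟨C, hC, hCw, hC1, -⟩ := exists_succ_core_zero hpt ht h
  obtain ⟨l, l', h1, h2, -⟩ := exists_crystalEdges_zero C.isBarCore (by omega) (by omega) hw hC1
  exact not_isExternal_of_crystalEdges hpt (by omega) hC hCw h1 h2

/-- The partition of `B` just below the weight `0` core along the `0`-string retains the part `t`
and has none congruent to `t + 1`: its only new part is a multiple of `p`. Its part `t` can be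
raised. -/
theorem not_atHighEnd_top {B : SpinBlock p} (hpt : p = 2 * t + 1) (ht : 1 ≤ t)
    (hw : 1 ≤ B.weight) (h1 : B.label 1 = B.weight) (h : 0 < B.label t) : ¬ AtHighEnd t B := by
  obtain ⟨C, hC, hCw, hC1, hCj⟩ := exists_succ_core_zero hpt ht h1
  obtain ⟨l, -, hl, -, hln, hgap, hmem⟩ :=
    exists_crystalEdges_zero C.isBarCore (by omega) (by omega) hw hC1
  have hCt : 0 < C.label t := by
    rcases ht.eq_or_lt with rfl | ht2
    · rw [hC1]; omega
    · rw [hCj t ht2 le_rfl]; exact h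
  have hCmem := C.isBarCore.mem_iff (by omega : p % 2 = 1)
  have hpw : p * 1 ≤ p * B.weight := Nat.mul_le_mul_left p hw
  obtain ⟨m, hm⟩ := exists_crystalEdge_top hpt ht hln hgap
    ((hmem t).2 ⟨ht, Or.inl ⟨by
      rw [hCmem, Nat.mod_eq_of_lt (by omega), Nat.div_eq_of_lt (by omega)]
      exact hCt, by omega⟩⟩) fun x hx hx1 => by
    rcases ((hmem x).1 hx).2 with ⟨h2, -⟩ | h2
    · rw [hCmem, hx1, show t + 1 = p - t by omega, charge_sub (by omega) (by omega)] at h2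
      simp only [label] at hCt
      exact absurd h2 (not_lt.2 ((by omega : _ ≤ (0 : ℤ)).trans (Int.natCast_nonneg _)))
    · rw [h2, Nat.mul_mod_right] at hx1
      omega
  obtain ⟨D, hD⟩ := exists_contains (by omega : 0 < p) hm.2.1.1
  exact fun hB => hB ⟨D, l, m, contains_of_crystalEdge_core hpt (by omega) hC hCw hl, hD, hm⟩

/-! ### Ranks and sums of squares -/

/-- The labels of a block, shifted so that its rank is a sum of squares up to a constant. -/
def shiftedLabel (B : SpinBlock p) (i : ℕ) : ℤ := 2 * p * B.label i + (2 * i - p)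

/-- Completing the square: `z ^ 2 = 4 p (p n ^ 2 + (2 i - p) n) + (2 i - p) ^ 2`. -/
theorem sum_shiftedLabel_sq (hpt : p = 2 * t + 1) (B : SpinBlock p) :
    ∑ i ∈ Finset.Icc 1 t, B.shiftedLabel i ^ 2 =
      8 * p * B.rank - 8 * p ^ 2 * B.weight + ∑ i ∈ Finset.Icc 1 t, (2 * (i : ℤ) - p) ^ 2 := by
  have h1 : ∑ i ∈ Finset.Icc 1 t, B.shiftedLabel i ^ 2 =
      4 * p * coreEnergy p t B.label + ∑ i ∈ Finset.Icc 1 t, (2 * (i : ℤ) - p) ^ 2 := by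
    rw [coreEnergy, Finset.mul_sum, ← Finset.sum_add_distrib]
    refine Finset.sum_congr rfl fun i _ => ?_
    rw [shiftedLabel]
    ring
  have h2 := B.two_mul_rank hpt
  change _ = coreEnergy p t B.label + _ at h2
  rw [h1]
  linear_combination -4 * (p : ℤ) * h2

theorem rank_lt_of_sum_lt (hpt : p = 2 * t + 1) {B C : SpinBlock p} (hw : B.weight = C.weight)
    (h : ∑ i ∈ Finset.Icc 1 t, B.shiftedLabel i ^ 2 < ∑ i ∈ Finset.Icc 1 t, C.shiftedLabel i ^ 2) :
    B.rank < C.rank := by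
  rw [sum_shiftedLabel_sq hpt, sum_shiftedLabel_sq hpt, hw] at h
  have h1 : (8 * p : ℤ) * B.rank < 8 * p * C.rank := by linarith
  have h2 := lt_of_mul_lt_mul_left h1 (by positivity)
  exact_mod_cast h2

/-! ### The block with the RoCK core -/

/-- The block of weight `w` with the RoCK core. -/
def IsRoCK (t : ℕ) (R : SpinBlock p) : Prop :=
  ∀ i, 1 ≤ i → i ≤ t → R.label i = R.weight + ((i : ℤ) - 1) * (R.weight - 1)

theorem exists_isRoCK (hpt : p = 2 * t + 1) (w : ℕ) :
    ∃ R : SpinBlock p, R.weight = w ∧ R.IsRoCK t := by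
  set n : ℕ → ℤ := fun i => w + ((i : ℤ) - 1) * (w - 1)
  obtain ⟨R, h1, h2⟩ := exists_charge_eq (p := p) (by omega)
    (N := fun r => if r = 0 then 0 else if r ≤ t then n r else - n (p - r))
    ⟨if_pos rfl, fun r h0 hr => by
      simp only
      rw [if_neg (by omega : ¬ p - r = 0), if_neg (by omega : ¬ r = 0)]
      by_cases h : r ≤ t
      · rw [if_neg (by omega : ¬ p - r ≤ t), if_pos h, Nat.sub_sub_self hr.le]
      · rw [if_pos (by omega : p - r ≤ t), if_neg h, neg_neg]⟩ w
  refine ⟨R, h1, fun i hi hit => ?_⟩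
  rw [label, h2 i (by omega), if_neg (by omega), if_pos hit, h1]

namespace IsRoCK

variable {R : SpinBlock p}

theorem shiftedLabel (hR : R.IsRoCK t) {i : ℕ} (hi : 1 ≤ i) (hit : i ≤ t) :
    R.shiftedLabel i = i * (2 * p * (R.weight - 1) + 2) + p := by
  rw [SpinBlock.shiftedLabel, hR i hi hit]
  ring

theorem weight_le_label (hR : R.IsRoCK t) (hw : 1 ≤ R.weight) {i : ℕ} (hi : 1 ≤ i) (hit : i ≤ t) :
    (R.weight : ℤ) ≤ R.label i := by
  rw [hR i hi hit]
  have := mul_nonneg (by omega : 0 ≤ (i : ℤ) - 1) (by omega : 0 ≤ (R.weight : ℤ) - 1)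
  linarith

theorem label_one (hR : R.IsRoCK t) (ht : 1 ≤ t) : R.label 1 = R.weight := by
  rw [hR 1 le_rfl ht]; simp

/-- All labels are positive, so the runners `p - i` are empty and the signed counts are the actual
counts. -/
theorem coreTuple (hR : R.IsRoCK t) (hpt : p = 2 * t + 1) (hw : 1 ≤ R.weight) {i : ℕ}
    (hi : 1 ≤ i) (hit : i ≤ t) :
    SpinCrystal.coreTuple p R.core i = (R.weight + (i - 1) * (R.weight - 1), 0) := by
  have h1 := hR i hi hit
  have h2 := hR.weight_le_label hw hi hit
  have hno : ∀ a ∈ parts R.core, a % p ≠ p - i := fun a ha h => by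
    rw [R.isBarCore.mem_iff (by omega), h, charge_sub (by omega) (by omega)] at ha
    simp only [label] at h2
    exact absurd ha (not_lt.2 ((by omega : _ ≤ (0 : ℤ)).trans (Int.natCast_nonneg _)))
  have h3 := charge_eq_countP (p := p) (parts R.core) i
  rw [Nat.mod_eq_of_lt (by omega : p - i < p), Multiset.countP_eq_zero.2 hno] at h3
  have h4 : (parts R.core).countP (fun a => a % p = i ∨ a % p = p - i) =
      (parts R.core).countP (fun a => a % p = i) :=
    Multiset.countP_congr rfl fun a ha => by simp [hno a ha]
  have h5 : (parts R.core).countP (fun a => a % p = i) =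
      R.weight + (i - 1) * (R.weight - 1) := by
    rw [label, h3] at h1
    generalize (parts R.core).countP (fun a => a % p = i) = c at h1 ⊢
    zify [hi, hw]
    simpa using h1
  rw [SpinCrystal.coreTuple, h4, h5, if_pos (by omega)]

theorem rank (hR : R.IsRoCK t) (hpt : p = 2 * t + 1) :
    (R.rank : ℚ) = p * R.weight + ((p : ℚ) * (R.weight - 1) / 2 + 1) *
      ∑ i ∈ Finset.Icc 1 t, ((i : ℚ) ^ 2 * (R.weight - 1) + i) := by
  have h1 := R.two_mul_rank hpt
  change _ = coreEnergy p t R.label + _ at h1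
  have h2 : coreEnergy p t R.label = (p * ((R.weight : ℤ) - 1) + 2) *
      ∑ i ∈ Finset.Icc 1 t, ((i : ℤ) ^ 2 * (R.weight - 1) + i) := by
    rw [coreEnergy, Finset.mul_sum]
    refine Finset.sum_congr rfl fun i hi => ?_
    rw [Finset.mem_Icc] at hi
    rw [hR i hi.1 hi.2]
    ring
  rw [h2] at h1
  have h3 : (2 : ℚ) * R.rank = (p * ((R.weight : ℚ) - 1) + 2) *
      ∑ i ∈ Finset.Icc 1 t, ((i : ℚ) ^ 2 * (R.weight - 1) + i) + 2 * p * R.weight := by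
    exact_mod_cast h1
  linear_combination (1 / 2 : ℚ) * h3

theorem rank_lt (hR : R.IsRoCK t) (hpt : p = 2 * t + 1) (ht : 1 ≤ t) (hw : 1 ≤ R.weight)
    {B : SpinBlock p} (hB : B.weight = R.weight) (hne : B ≠ R) (h1 : B.label 1 ≤ B.weight)
    (hs : ∀ i, 1 ≤ i → i < t → B.label (i + 1) ≤ B.label i + (B.weight - 1))
    (hlast : 1 - (B.weight : ℤ) ≤ 2 * B.label t) : B.rank < R.rank := by
  refine rank_lt_of_sum_lt hpt hB ?_
  have hp : (0 : ℤ) < p := by omega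
  have hpz : (p : ℤ) = 2 * t + 1 := by exact_mod_cast hpt
  have hw' : (0 : ℤ) ≤ R.weight - 1 := by omega
  rw [hB] at h1 hs hlast
  have hsum : ∑ i ∈ Finset.Icc 1 t, R.shiftedLabel i ^ 2 =
      ∑ i ∈ Finset.Icc 1 t, ((i : ℤ) * (2 * p * (R.weight - 1) + 2) + p) ^ 2 :=
    Finset.sum_congr rfl fun i hi => by
      rw [hR.shiftedLabel (Finset.mem_Icc.1 hi).1 (Finset.mem_Icc.1 hi).2]
  rw [hsum]
  -- Here `b = p` and `c = 2 p (w - 1) + 2`. Since `2 t - p = -1`, the last shifted label is `2 p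
  -- n_t - 1`, and `2 n_t ≥ 1 - w` becomes the end condition `-c ≤ 2 z_t`.
  refine sum_sq_lt_of_steps hp (by positivity) ht ?_ (fun i hi hit => ?_) ?_ ?_
  · rw [SpinBlock.shiftedLabel]
    have := mul_le_mul_of_nonneg_left h1 (by positivity : (0 : ℤ) ≤ 2 * p)
    push_cast
    linarith
  · rw [SpinBlock.shiftedLabel, SpinBlock.shiftedLabel]
    have := mul_le_mul_of_nonneg_left (hs i hi hit) (by positivity : (0 : ℤ) ≤ 2 * p)
    push_cast
    linarith
  · rw [SpinBlock.shiftedLabel]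
    have := mul_le_mul_of_nonneg_left hlast (by positivity : (0 : ℤ) ≤ 2 * p)
    linarith
  · by_contra hc
    push Not at hc
    refine hne (ext_label hpt hB fun i hi hit => ?_)
    have h2 := hc i hi hit
    rw [← hR.shiftedLabel hi hit, SpinBlock.shiftedLabel, SpinBlock.shiftedLabel] at h2
    exact mul_left_cancel₀ (by positivity : (2 * p : ℤ) ≠ 0) (by linarith)

theorem not_isExternal (hR : R.IsRoCK t) (hpt : p = 2 * t + 1) (hw : 1 ≤ R.weight) {i : ℕ}
    (hit : i < t) : ¬ IsExternal i R := by
  rcases Nat.eq_zero_or_pos i with rfl | hi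
  · exact not_isExternal_zero hpt (by omega) hw (hR.label_one (by omega))
  · refine not_isExternal_mid hpt hi hit hw ?_
    rw [hR (i + 1) (by omega) hit, hR i hi hit.le]
    push_cast
    ring

theorem not_atHighEnd (hR : R.IsRoCK t) (hpt : p = 2 * t + 1) (ht : 1 ≤ t) (hw : 1 ≤ R.weight)
    {i : ℕ} (hit : i ≤ t) : ¬ AtHighEnd i R := by
  rcases hit.eq_or_lt with rfl | hit
  · exact not_atHighEnd_top hpt ht hw (hR.label_one ht)
      (by have := hR.weight_le_label hw ht le_rfl; omega)
  · exact fun h => hR.not_isExternal hpt hw hit (Or.inl h)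

end IsRoCK

/-! ### Blocks that cannot be lowered -/

theorem label_bounds_of_not_canBeLowered (hpt : p = 2 * t + 1) (ht : 1 ≤ t) {B : SpinBlock p}
    (hw : 1 ≤ B.weight) (h : ¬ B.CanBeLowered) : B.label 1 ≤ B.weight ∧
      (∀ i, 1 ≤ i → i < t → B.label (i + 1) ≤ B.label i + (B.weight - 1)) ∧
      1 - (B.weight : ℤ) ≤ 2 * B.label t := by
  refine ⟨?_, fun i hi hit => ?_, ?_⟩
  · by_contra hc
    obtain ⟨C, h1, h2, h3⟩ := exists_isScopesImage_zero hpt ht B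
    have h4 := rank_eq_of_scopes_zero hpt ht h1.2 h2 h3
    exact h ⟨C, ⟨0, by omega, Or.inl (atHighEnd_zero hpt ht (by omega)), h1⟩, by omega⟩
  · by_contra hc
    obtain ⟨C, h1, h2, h3, h4⟩ := exists_isScopesImage_mid hpt hi hit B
    have h5 := rank_eq_of_scopes_mid hpt hi hit h1.2 h2 h3 h4
    exact h ⟨C, ⟨i, by omega, Or.inl (atHighEnd_mid hpt hi hit (by omega)), h1⟩, by omega⟩
  -- The bound `1 - w`, one weaker than the string condition allows, ensures that its negation makes
  -- `n_t` negative even for `w = 1`, so that `K_t` strictly lowers the rank.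
  · by_contra hc
    obtain ⟨C, h1, h2, h3⟩ := exists_isScopesImage_top hpt ht B
    have h4 := rank_eq_of_scopes_top hpt ht h1.2 h2 h3
    exact h ⟨C, ⟨t, by omega, Or.inl (atHighEnd_top hpt ht (by omega)), h1⟩, by omega⟩

theorem label_bounds_of_not_atHighEnd (hpt : p = 2 * t + 1) (ht : 1 ≤ t) {B : SpinBlock p}
    (h : ∀ i ≤ t, ¬ B.AtHighEnd i) : B.label 1 ≤ B.weight ∧
      (∀ i, 1 ≤ i → i < t → B.label (i + 1) ≤ B.label i + (B.weight - 1)) ∧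
      1 - (B.weight : ℤ) ≤ 2 * B.label t := by
  refine ⟨?_, fun i hi hit => ?_, ?_⟩
  · by_contra hc
    exact h 0 (by omega) (atHighEnd_zero hpt ht (by omega))
  · by_contra hc
    exact h i hit.le (atHighEnd_mid hpt hi hit (by omega))
  · by_contra hc
    exact h t le_rfl (atHighEnd_top hpt ht (by omega))

/-! ### Blocks allowed equivalent to the block with the RoCK core -/

/-- The inequalities on the labels of a block that are preserved by allowed actions and hold for
the block with the RoCK core. -/
def IsSeparated (t : ℕ) (B : SpinBlock p) : Prop :=
  (∀ i, 1 ≤ i → i ≤ t → (B.weight : ℤ) ≤ B.label i ∨ B.label i ≤ -B.weight) ∧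
  ∀ i j, 1 ≤ i → i < j → j ≤ t →
    ((B.weight : ℤ) - 1 ≤ B.label j - B.label i ∨ B.label j - B.label i ≤ -B.weight) ∧
    ((B.weight : ℤ) ≤ B.label i + B.label j ∨ B.label i + B.label j ≤ 1 - B.weight)

theorem IsRoCK.isSeparated {R : SpinBlock p} (hR : R.IsRoCK t) (hw : 1 ≤ R.weight) :
    R.IsSeparated t := by
  refine ⟨fun i hi hit => Or.inl (hR.weight_le_label hw hi hit), fun i j hi hij hjt => ?_⟩
  have h1 := hR.weight_le_label hw hi (by omega)
  have h2 := hR.weight_le_label hw (by omega : 1 ≤ j) hjt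
  refine ⟨Or.inl ?_, Or.inl (by omega)⟩
  rw [hR i hi (by omega), hR j (by omega) hjt]
  have := mul_nonneg (by omega : 0 ≤ (j : ℤ) - i - 1) (by omega : 0 ≤ (R.weight : ℤ) - 1)
  linarith

/-- Each `K_k` acts on the labels as a reflection permuting the inequalities. `K_0` and `K_t`
interchange conditions on sums and differences; only the equalities `n_1 = w` and `n_{k+1} = n_k + w
- 1` could be carried to a violation, and there the block is not external. -/
theorem IsSeparated.of_allowedAction (hpt : p = 2 * t + 1) (ht : 1 ≤ t) {B C : SpinBlock p}
    (hw : 1 ≤ B.weight) (hB : B.IsSeparated t) (h : AllowedAction B C) : C.IsSeparated t := by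
  obtain ⟨k, hk, hext, himg⟩ := h
  have hkt : k ≤ t := by omega
  have hCw : C.weight = B.weight := himg.2
  obtain ⟨hB1, hB2⟩ := hB
  rw [IsSeparated, hCw]
  rcases Nat.eq_zero_or_pos k with rfl | hk0
  · obtain ⟨C', h1, h2, h3⟩ := exists_isScopesImage_zero hpt ht B
    obtain rfl := himg.unique h1
    have hne : B.label 1 ≠ B.weight := fun h => not_isExternal_zero hpt ht hw h hext
    refine ⟨fun i hi hit => ?_, fun i j hi hij hjt => ?_⟩
    · have := hB1 i hi hit
      rcases hi.eq_or_lt with rfl | hi2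
      · omega
      · rw [h3 i hi2 hit]; exact this
    · have := hB2 i j hi hij hjt
      rw [h3 j (by omega) hjt]
      rcases hi.eq_or_lt with rfl | hi2
      · omega
      · rw [h3 i hi2 (by omega)]; exact this
  · rcases hkt.eq_or_lt with rfl | hkt
    · obtain ⟨C', h1, h2, h3⟩ := exists_isScopesImage_top hpt ht B
      obtain rfl := himg.unique h1
      refine ⟨fun i hi hit => ?_, fun i j hi hij hjt => ?_⟩
      · have := hB1 i hi hit
        rcases hit.eq_or_lt with rfl | hit
        · omega
        · rw [h3 i hi hit]; exact this
      · have := hB2 i j hi hij hjt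
        rw [h3 i hi (by omega)]
        rcases hjt.eq_or_lt with rfl | hjt
        · omega
        · rw [h3 j (by omega) hjt]; exact this
    · obtain ⟨C', h1, h2, h3, h4⟩ := exists_isScopesImage_mid hpt hk0 hkt B
      obtain rfl := himg.unique h1
      have hne : B.label (k + 1) ≠ B.label k + B.weight - 1 := fun h =>
        not_isExternal_mid hpt hk0 hkt hw h hext
      have hval : ∀ i, 1 ≤ i → i ≤ t →
          C.label i = B.label (if i = k then k + 1 else if i = k + 1 then k else i) := by
        intro i hi hit
        split_ifs with e1 e2
        · rw [e1, h2]
        · rw [e2, h3]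
        · exact h4 i hi hit e1 e2
      refine ⟨fun i hi hit => ?_, fun i j hi hij hjt => ?_⟩
      · rw [hval i hi hit]
        exact hB1 _ (by split_ifs <;> omega) (by split_ifs <;> omega)
      · rw [hval i hi (by omega), hval j (by omega) hjt]
        -- Only the pair swapped by `K_k` has its difference negated. The ranges `≥ w - 1` and `≤
        -- -w` are not symmetric, and `hne` removes exactly the offending value `w - 1`.
        by_cases he : i = k ∧ j = k + 1
        · obtain ⟨rfl, rfl⟩ := he
          have := hB2 i (i + 1) hi hij hjt
          rw [if_pos rfl, if_neg (by omega), if_pos rfl]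
          omega
        · exact hB2 _ _ (by split_ifs <;> omega) (by split_ifs <;> omega) (by split_ifs <;> omega)

theorem le_abs_abs_sub_abs {a b c : ℤ} (h1 : c ≤ |a - b|) (h2 : c ≤ |a + b|) :
    c ≤ |(|a| - |b|)| := by
  rcases abs_cases a with ⟨ha, -⟩ | ⟨ha, -⟩ <;> rcases abs_cases b with ⟨hb, -⟩ | ⟨hb, -⟩ <;>
    rw [ha, hb]
  · exact h1
  · rwa [sub_neg_eq_add]
  · rwa [← abs_neg, show -(-a - b) = a + b by ring]
  · rwa [← abs_neg, show -(-a - -b) = a - b by ring]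

/-- The offsets `2 i - p` turn the asymmetric bounds on labels, their differences and sums into
uniform ones: every `|z_i|` is at least `c + p`, and any two of them differ by at least `c`. The
RoCK block attains the least sum of squares under these conditions. -/
theorem IsRoCK.rank_le_of_isSeparated {R B : SpinBlock p} (hR : R.IsRoCK t) (hpt : p = 2 * t + 1)
    (hw : 1 ≤ R.weight) (hBw : B.weight = R.weight) (hB : B.IsSeparated t) : R.rank ≤ B.rank := by
  refine not_lt.1 fun hlt => ?_
  have hp : (0 : ℤ) < p := by omega
  have hpz : (p : ℤ) = 2 * t + 1 := by exact_mod_cast hpt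
  obtain ⟨hB1, hB2⟩ := hB
  rw [hBw] at hB1 hB2
  have hw' : (0 : ℤ) ≤ R.weight - 1 := by omega
  have hmul : ∀ x y : ℤ, x ≤ y → 2 * p * x ≤ 2 * p * y := fun x y hxy =>
    mul_le_mul_of_nonneg_left hxy (by positivity)
  have h1 := (le_sum_sq_of_gaps (z := B.shiftedLabel) (b := p)
    (c := 2 * p * ((R.weight : ℤ) - 1) + 2) hp.le (by positivity) (Finset.Icc 1 t)
    (fun i hi => ?_) ?_).1
  · rw [Nat.card_Icc, Nat.add_sub_cancel, Finset.sum_congr (s₂ := Finset.Icc 1 t) rfl fun i hi => by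
      rw [← hR.shiftedLabel (Finset.mem_Icc.1 hi).1 (Finset.mem_Icc.1 hi).2],
      sum_shiftedLabel_sq hpt, sum_shiftedLabel_sq hpt, hBw] at h1
    have h2 : (8 * p : ℤ) * R.rank ≤ 8 * p * B.rank := by linarith
    have h3 := le_of_mul_le_mul_left h2 (by positivity)
    omega
  · rw [Finset.mem_Icc] at hi
    rw [le_abs, SpinBlock.shiftedLabel]
    rcases hB1 i hi.1 hi.2 with h | h
    · have := hmul _ _ h
      left
      linarith [(by omega : (1 : ℤ) ≤ i)]
    · have := hmul _ _ h
      right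
      linarith [(by omega : (i : ℤ) ≤ t)]
  · have key : ∀ i j, 1 ≤ i → i < j → j ≤ t → 2 * p * ((R.weight : ℤ) - 1) + 2 ≤
        |(|B.shiftedLabel i| - |B.shiftedLabel j|)| := by
      intro i j hi hij hjt
      have hi' : (1 : ℤ) ≤ i := by omega
      have hij' : (i : ℤ) + 1 ≤ j := by omega
      have hjt' : (j : ℤ) ≤ t := by omega
      obtain ⟨h1, h2⟩ := hB2 i j hi hij hjt
      refine le_abs_abs_sub_abs ?_ ?_
      · rw [le_abs, SpinBlock.shiftedLabel, SpinBlock.shiftedLabel]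
        rcases h1 with h | h
        · have := hmul _ _ h
          right
          linarith
        · have := hmul _ _ h
          left
          linarith
      · rw [le_abs, SpinBlock.shiftedLabel, SpinBlock.shiftedLabel]
        rcases h2 with h | h
        · have := hmul _ _ h
          left
          linarith
        · have := hmul _ _ h
          right
          linarith
    intro i hi j hj hne
    rw [Finset.mem_Icc] at hi hj
    rcases lt_or_gt_of_ne hne with h | h
    · exact key i j hi.1 h hj.2
    · rw [abs_sub_comm]
      exact key j i hj.1 h hi.2

theorem IsRoCK.rank_le_of_allowedEquivalent {R C : SpinBlock p} (hR : R.IsRoCK t)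
    (hpt : p = 2 * t + 1) (ht : 1 ≤ t) (hw : 1 ≤ R.weight) (h : R.AllowedEquivalent C) :
    R.rank ≤ C.rank := by
  have key : C.weight = R.weight ∧ C.IsSeparated t := by
    induction h with
    | refl => exact ⟨rfl, hR.isSeparated hw⟩
    | tail _ hBC ih =>
      refine ⟨?_, ih.2.of_allowedAction hpt ht (by omega) hBC⟩
      obtain ⟨i, -, -, h1⟩ := hBC
      rw [h1.2, ih.1]
  exact hR.rank_le_of_isSeparated hpt hw key.1 key.2

theorem IsRoCK.not_canBeLowered {R : SpinBlock p} (hR : R.IsRoCK t) (hpt : p = 2 * t + 1)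
    (ht : 1 ≤ t) (hw : 1 ≤ R.weight) : ¬ R.CanBeLowered := by
  rintro ⟨C, hC, hlt⟩
  exact absurd (hR.rank_le_of_allowedEquivalent hpt ht hw (Relation.ReflTransGen.single hC))
    (not_le.2 hlt)

/-- If all blocks that cannot be lowered have rank at most `N`, then every block is allowed
equivalent to a block of rank at most `N`. -/
theorem exists_allowedEquivalent_rank_le {w N : ℕ}
    (h : ∀ B : SpinBlock p, B.weight = w → ¬ B.CanBeLowered → B.rank ≤ N) (B : SpinBlock p)
    (hB : B.weight = w) : ∃ C : SpinBlock p, B.AllowedEquivalent C ∧ C.rank ≤ N := by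
  induction hn : B.rank using Nat.strong_induction_on generalizing B with
  | _ n ih =>
    by_cases hlow : B.CanBeLowered
    · obtain ⟨D, hD, hlt⟩ := hlow
      have hDw : D.weight = w := by
        obtain ⟨i, -, -, h1⟩ := hD
        rw [h1.2, hB]
      obtain ⟨C, hC, hCN⟩ := ih D.rank (hn ▸ hlt) D hDw rfl
      exact ⟨C, Relation.ReflTransGen.head hD hC, hCN⟩
    · exact ⟨B, Relation.ReflTransGen.refl, h B hB hlow⟩

end SpinBlock

end SpinCrystal

/-! ### The theorem -/

theorem mainTheorem2 (p t w : ℕ) (hp : p.Prime) (hpt : p = 2 * t + 1) (hw : 1 ≤ w) :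
    ∃ R : SpinCrystal.SpinBlock p,
      -- `R` is the block of weight `w` with the RoCK core
      R.weight = w ∧
      (∀ i, 1 ≤ i → i ≤ t →
        SpinCrystal.coreTuple p R.core i = (w + (i - 1) * (w - 1), 0)) ∧
      -- its rank
      (R.rank : ℚ) = p * w + ((p : ℚ) * (w - 1) / 2 + 1) *
        ∑ i ∈ Finset.Icc 1 t, ((i : ℚ) ^ 2 * (w - 1) + i) ∧
      -- it is the unique block of maximal rank among those that cannot be lowered
      ¬ R.CanBeLowered ∧
      (∀ B : SpinCrystal.SpinBlock p, B.weight = w → ¬ B.CanBeLowered → B ≠ R →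
        B.rank < R.rank) ∧
      -- and among those that lie at the high-rank end of no string
      (∀ i ≤ t, ¬ R.AtHighEnd i) ∧
      (∀ B : SpinCrystal.SpinBlock p, B.weight = w → (∀ i ≤ t, ¬ B.AtHighEnd i) → B ≠ R →
        B.rank < R.rank) ∧
      -- every block of weight `w` is allowed equivalent to one of rank at most that of `R`
      (∀ B : SpinCrystal.SpinBlock p, B.weight = w →
        ∃ C : SpinCrystal.SpinBlock p, B.AllowedEquivalent C ∧ C.rank ≤ R.rank) ∧
      -- and this bound is sharp
      (∀ C : SpinCrystal.SpinBlock p, R.AllowedEquivalent C → R.rank ≤ C.rank) := by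

  -- Primality enters only here, to exclude `t = 0`.
  have ht : 1 ≤ t := by
    have := hp.two_le
    omega
  obtain ⟨R, hRw, hR⟩ := SpinCrystal.SpinBlock.exists_isRoCK hpt w
  subst hRw
  have hlow : ∀ B : SpinCrystal.SpinBlock p, B.weight = R.weight → ¬ B.CanBeLowered → B ≠ R →
      B.rank < R.rank := fun B hB h hne => by
    obtain ⟨h1, h2, h3⟩ := SpinCrystal.SpinBlock.label_bounds_of_not_canBeLowered hpt ht
      (by omega) h
    exact hR.rank_lt hpt ht hw hB hne h1 h2 h3
  refine ⟨R, rfl, fun i hi hit => hR.coreTuple hpt hw hi hit, hR.rank hpt,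
    hR.not_canBeLowered hpt ht hw, hlow, fun i hit => hR.not_atHighEnd hpt ht hw hit,
    fun B hB h hne => ?_, fun B hB => ?_,
    fun C hC => hR.rank_le_of_allowedEquivalent hpt ht hw hC⟩
  · obtain ⟨h1, h2, h3⟩ := SpinCrystal.SpinBlock.label_bounds_of_not_atHighEnd hpt ht h
    exact hR.rank_lt hpt ht hw hB hne h1 h2 h3
  · refine SpinCrystal.SpinBlock.exists_allowedEquivalent_rank_le (fun D hD h => ?_) B hB
    by_cases hDR : D = R
    · exact hDR ▸ le_rfl
    · exact (hlow D hD h hDR).le
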